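/- All groups are finite. Let $\Omega_{\mathbb C}$ be the biset category: its objects are all finite groups, $\mathrm{Hom}(G,H)=\mathbb C B(H,G)=\mathbb C\otimes_{\mathbb Z}B(H,G)$, where $B(H,G)$ is the Grothendieck group (for disjoint unions) of finite $(H,G)$-bisets, and composition is induced by $(Y,X)\mapsto Y\times_H X$. A biset functor is a $\mathbb C$-linear functor from $\Omega_{\mathbb C}$ to complex vector spaces. A Green biset functor is a biset functor $A$ with bilinear products $A(G)\times A(H)\to A(G\times H)$ and an element $\varepsilon_A\in A(1)$ that are associative, unital (both up to the canonical group isomorphisms) and functorial, i.e. $A(\varphi\times\psi)(a\times b)=A(\varphi)(a)\times A(\psi)(b)$. An $A$-module is a biset functor $M$ with bilinear products $A(G)\times M(H)\to M(G\times H)$ satisfying the analogous associativity, left unit and functoriality conditions. A submodule is a subfunctor stable under these products, an isomorphism of modules is an isomorphism of biset functors commuting with these products, and a module is simple if it is nonzero and its only submodules are $0$ and itself. A two-sided ideal of $A$ is a subfunctor stable under the products on the left and on the right with elements of $A$; a Green biset functor is simple if it is nonzero and its only two-sided ideals are $0$ and itself. Let $\mathbb C R_{\mathbb C}$ be the Green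 biset functor with $\mathbb C R_{\mathbb C}(G)=\mathbb C\otimes_{\mathbb Z}R_{\mathbb C}(G)$, where $R_{\mathbb C}(G)$ is the Grothendieck group of finitely generated $\mathbb C G$-modules. An $(H,G)$-biset $X$ acts by $[V]\mapsto[\mathbb C X\otimes_{\mathbb C G}V]$, the products are $[V]\times[W]=[V\otimes_{\mathbb C}W]$ with $G\times H$ acting on $V$ through $G$ and on $W$ through $H$, and $\varepsilon\in\mathbb C R_{\mathbb C}(1)$ is the class of $\mathbb C$. **Proposition.** As a module over itself, $\mathbb C R_{\mathbb C}$ is simple, and every simple $\mathbb C R_{\mathbb C}$-module is isomorphic to $\mathbb C R_{\mathbb C}$. Moreover, $\mathbb C R_{\mathbb C}$ is a simple Green biset functor. -/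

import Mathlib

open scoped TensorProduct

universe v w

noncomputable section

namespace GreenBiset

/-! ## Grothendieck groups and their extension of scalars to the complex numbers -/

/-- The abelian group with one generator `[a]` for each `a : α` and one relation
`[a] = [b] + [c]` for each triple with `r a b c`. -/
def Groth {α : Type v} (r : α → α → α → Prop) : Type v :=
  FreeAbelianGroup α ⧸ AddSubgroup.closure
    {x : FreeAbelianGroup α | ∃ a b c, r a b c ∧
      x = FreeAbelianGroup.of a - (FreeAbelianGroup.of b + FreeAbelianGroup.of c)}

instance {α : Type v} (r : α → α → α → Prop) : AddCommGroup (Groth r) :=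
  inferInstanceAs (AddCommGroup (FreeAbelianGroup α ⧸ AddSubgroup.closure _))

/-- The class `[a]` of a generator. -/
def Groth.of {α : Type v} {r : α → α → α → Prop} (a : α) : Groth r :=
  QuotientAddGroup.mk (FreeAbelianGroup.of a)

/-- The complexification `ℂ ⊗_ℤ Groth r`. -/
def CK {α : Type v} (r : α → α → α → Prop) : Type v := ℂ ⊗[ℤ] Groth r

namespace CK

variable {α : Type v} {r : α → α → α → Prop} {M : Type w} [AddCommGroup M] [Module ℂ M]

instance : AddCommGroup (CK r) := inferInstanceAs (AddCommGroup (ℂ ⊗[ℤ] Groth r))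
instance : Module ℂ (CK r) := inferInstanceAs (Module ℂ (ℂ ⊗[ℤ] Groth r))

/-- The element `1 ⊗ [a]`. -/
def of (a : α) : CK r := (1 : ℂ) ⊗ₜ[ℤ] (Groth.of a : Groth r)

theorem of_rel {a b c : α} (h : r a b c) : (of a : CK r) = of b + of c := by
  have : (Groth.of a : Groth r) = Groth.of b + Groth.of c := by
    have h0 : (QuotientAddGroup.mk (FreeAbelianGroup.of a -
        (FreeAbelianGroup.of b + FreeAbelianGroup.of c)) : Groth r) = 0 :=
      (QuotientAddGroup.eq_zero_iff _).2 (AddSubgroup.subset_closure ⟨a, b, c, h, rfl⟩)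
    exact sub_eq_zero.1 h0
  show (1 : ℂ) ⊗ₜ[ℤ] _ = (1 : ℂ) ⊗ₜ[ℤ] _ + (1 : ℂ) ⊗ₜ[ℤ] _
  rw [this]
  exact TensorProduct.tmul_add _ _ _

theorem of_eq {a b z : α} (h : r a b z) (hz : r z z z) : (of a : CK r) = of b := by
  have h1 : (of z : CK r) = 0 := by simpa using of_rel hz
  rw [of_rel h, h1, add_zero]

/-- The additive extension of a function that respects the relations. -/
def liftAux (f : α → M) (h : ∀ a b c, r a b c → f a = f b + f c) : Groth r →+ M :=
  QuotientAddGroup.lift _ (FreeAbelianGroup.lift f) <| by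
    rw [AddSubgroup.closure_le]
    rintro x ⟨a, b, c, hr, rfl⟩
    simp [h a b c hr]

/-- The linear extension of a function that respects the relations. -/
def lift (f : α → M) (h : ∀ a b c, r a b c → f a = f b + f c) : CK r →ₗ[ℂ] M :=
  (LinearMap.liftBaseChange ℂ (liftAux f h).toIntLinearMap : ℂ ⊗[ℤ] Groth r →ₗ[ℂ] M)

@[simp]
theorem lift_of (f : α → M) (h : ∀ a b c, r a b c → f a = f b + f c) (a : α) :
    lift f h (of a) = f a := by
  refine (LinearMap.liftBaseChange_tmul _ _ _ _).trans ?_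
  rw [one_smul]
  exact FreeAbelianGroup.lift_apply_of f a

theorem hom_ext {f g : CK r →ₗ[ℂ] M} (h : ∀ a, f (of a) = g (of a)) : f = g := by
  have key : ∀ x : Groth r, f ((1 : ℂ) ⊗ₜ[ℤ] x : ℂ ⊗[ℤ] Groth r) =
      g ((1 : ℂ) ⊗ₜ[ℤ] x : ℂ ⊗[ℤ] Groth r) := by
    intro x
    let F : Groth r →+ CK r := (TensorProduct.mk ℤ ℂ (Groth r) 1).toAddMonoidHom
    have : (f.toAddMonoidHom.comp F).comp (QuotientAddGroup.mk' _) =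
        (g.toAddMonoidHom.comp F).comp (QuotientAddGroup.mk' _) :=
      FreeAbelianGroup.lift_ext _ _ h
    obtain ⟨y, rfl⟩ := QuotientAddGroup.mk_surjective x
    exact DFunLike.congr_fun this y
  refine LinearMap.ext fun (x : ℂ ⊗[ℤ] Groth r) => ?_
  induction x using TensorProduct.induction_on with
  | zero => exact (map_zero f).trans (map_zero g).symm
  | tmul z y =>
    have : (z ⊗ₜ[ℤ] y : ℂ ⊗[ℤ] Groth r) = z • ((1 : ℂ) ⊗ₜ[ℤ] y) := by
      rw [TensorProduct.smul_tmul', smul_eq_mul, mul_one]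
    rw [this]
    exact (map_smul f z _).trans ((congrArg (z • ·) (key y)).trans (map_smul g z _).symm)
  | add x y hx hy =>
    exact (map_add f x y).trans ((congrArg₂ (· + ·) hx hy).trans (map_add g x y).symm)

/-- The classes of the generators span `ℂ ⊗_ℤ Groth r`. -/
@[elab_as_elim]
theorem induction {P : CK r → Prop} (of : ∀ a, P (of a)) (zero : P 0)
    (add : ∀ x y, P x → P y → P (x + y)) (smul : ∀ (z : ℂ) x, P x → P (z • x)) (x : CK r) :
    P x := by
  have h : (Submodule.span ℂ (Set.range (CK.of : α → CK r))).mkQ = 0 :=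
    hom_ext fun a => (Submodule.Quotient.mk_eq_zero _).2 (Submodule.subset_span ⟨a, rfl⟩)
  have hx : x ∈ Submodule.span ℂ (Set.range (CK.of : α → CK r)) :=
    (Submodule.Quotient.mk_eq_zero _).1 (LinearMap.congr_fun h x)
  induction hx using Submodule.span_induction with
  | mem x hx => obtain ⟨a, rfl⟩ := hx; exact of a
  | zero => exact zero
  | add x y _ _ hx hy => exact add x y hx hy
  | smul z x _ hx => exact smul z x hx

variable {β : Type v} {s : β → β → β → Prop}

/-- The bilinear extension of a function of two variables that respects the relations. -/
def lift₂ (f : α → β → M) (h : ∀ a b c, r a b c → ∀ x, f a x = f b x + f c x)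
    (h' : ∀ x a b c, s a b c → f x a = f x b + f x c) : CK r →ₗ[ℂ] CK s →ₗ[ℂ] M :=
  lift (fun a => lift (f a) (h' a)) fun a b c hr =>
    hom_ext fun x => by simp [h a b c hr x]

@[simp]
theorem lift₂_of (f : α → β → M) (h : ∀ a b c, r a b c → ∀ x, f a x = f b x + f c x)
    (h' : ∀ x a b c, s a b c → f x a = f x b + f x c) (a : α) (b : β) :
    lift₂ f h h' (of a) (of b) = f a b := by
  simp [lift₂]

end CK

/-! ## Bisets and the biset category -/

/-- A finite `(H, G)`-biset: a finite set with a left action `l` of `H` and a right action `r`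
of `G` that commute. -/
structure Biset (H G : Type) [Group H] [Group G] where
  X : Type
  fin : Finite X
  l : H → X → X
  r : X → G → X
  one_l : ∀ x, l 1 x = x
  mul_l : ∀ h h' x, l (h * h') x = l h (l h' x)
  one_r : ∀ x, r x 1 = x
  mul_r : ∀ x g g', r x (g * g') = r (r x g) g'
  comm : ∀ h x g, r (l h x) g = l h (r x g)

attribute [instance] Biset.fin

namespace Biset

section
variable {H G K L H' G' K' : Type} [Group H] [Group G] [Group K] [Group L]
  [Group H'] [Group G'] [Group K']

/-- Isomorphisms of bisets. -/
structure Iso (X Y : Biset H G) extends X.X ≃ Y.X where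
  map_l : ∀ h x, toFun (X.l h x) = Y.l h (toFun x)
  map_r : ∀ x g, toFun (X.r x g) = Y.r (toFun x) g

/-- The disjoint union of two bisets. -/
abbrev sum (X Y : Biset H G) : Biset H G where
  X := X.X ⊕ Y.X
  fin := inferInstance
  l h := Sum.map (X.l h) (Y.l h)
  r x g := Sum.map (fun x => X.r x g) (fun y => Y.r y g) x
  one_l := by rintro (x | x) <;> simp [one_l]
  mul_l := by rintro h h' (x | x) <;> simp [mul_l]
  one_r := by rintro (x | x) <;> simp [one_r]
  mul_r := by rintro (x | x) <;> simp [mul_r]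
  comm := by rintro h (x | x) <;> simp [comm]

/-- The empty biset. -/
abbrev empty (H G : Type) [Group H] [Group G] : Biset H G where
  X := Empty
  fin := inferInstance
  l _ x := x
  r x _ := x
  one_l := by simp
  mul_l := by simp
  one_r := by simp
  mul_r := by simp
  comm := by simp

/-- The `(H, G)`-biset `Iso(f)` of a group isomorphism `f : G → H`: the set `H`, with `H` acting by
left multiplication and `g : G` by right multiplication by `f g`. -/
abbrev iso (f : G ≃* H) [Finite H] : Biset H G where
  X := H
  fin := inferInstance
  l h x := h * x
  r x g := x * f g
  one_l := by simp
  mul_l := by simp [mul_assoc]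
  one_r := by simp
  mul_r := by simp [mul_assoc]
  comm := by simp [mul_assoc]

/-- The `(G, G)`-biset `G`. -/
abbrev id (G : Type) [Group G] [Finite G] : Biset G G := iso (MulEquiv.refl G)

/-- The orbit relation on `Y × X` for the right action of `H` given by
`(y, x) · h = (y · h, h⁻¹ · x)`. -/
def compSetoid (Y : Biset K H) (X : Biset H G) : Setoid (Y.X × X.X) where
  r p q := ∃ h : H, q = (Y.r p.1 h, X.l h⁻¹ p.2)
  iseqv := by
    refine ⟨fun p => ⟨1, by simp [one_l, one_r]⟩, ?_, ?_⟩
    · rintro p q ⟨h, rfl⟩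
      exact ⟨h⁻¹, by simp [← mul_r, ← mul_l, one_r, one_l]⟩
    · rintro p q t ⟨h, rfl⟩ ⟨h', rfl⟩
      exact ⟨h * h', by simp [mul_r, mul_l]⟩

/-- The composition `Y ×_H X` of a `(K, H)`-biset and an `(H, G)`-biset. -/
abbrev comp (Y : Biset K H) (X : Biset H G) : Biset K G where
  X := Quotient (compSetoid Y X)
  fin := inferInstance
  l k := Quotient.map (fun p => (Y.l k p.1, p.2)) <| by
    rintro p q ⟨h, rfl⟩
    exact ⟨h, by simp [Y.comm]⟩
  r x g := Quotient.map (fun p => (p.1, X.r p.2 g)) (by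
    rintro p q ⟨h, rfl⟩
    exact ⟨h, by simp [X.comm]⟩) x
  one_l := by rintro ⟨x⟩; exact congrArg (Quotient.mk _) (by simp [one_l])
  mul_l := by rintro h h' ⟨x⟩; exact congrArg (Quotient.mk _) (by simp [mul_l])
  one_r := by rintro ⟨x⟩; exact congrArg (Quotient.mk _) (by simp [one_r])
  mul_r := by rintro ⟨x⟩ g g'; exact congrArg (Quotient.mk _) (by simp [mul_r])
  comm := by rintro h ⟨x⟩ g; rfl

/-- The class of `(y, x)` in `Y ×_H X`. -/
def comp.mk (Y : Biset K H) (X : Biset H G) (y : Y.X) (x : X.X) : (comp Y X).X :=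
  Quotient.mk (compSetoid Y X) (y, x)

theorem comp.mk_r (Y : Biset K H) (X : Biset H G) (y : Y.X) (h : H) (x : X.X) :
    comp.mk Y X (Y.r y h) x = comp.mk Y X y (X.l h x) :=
  (Quotient.sound (s := compSetoid Y X)
    ⟨h, by simp [← mul_l, one_l]⟩ : comp.mk Y X y (X.l h x) = comp.mk Y X (Y.r y h) x).symm

/-- Functions out of `Y ×_H X`. -/
def comp.lift {Y : Biset K H} {X : Biset H G} {T : Type*} (f : Y.X → X.X → T)
    (hf : ∀ y h x, f (Y.r y h) x = f y (X.l h x)) : (comp Y X).X → T :=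
  Quotient.lift (fun p => f p.1 p.2) <| by
    rintro p q ⟨h, rfl⟩
    simp [hf, ← mul_l, one_l]

theorem comp.ind {Y : Biset K H} {X : Biset H G} {P : (comp Y X).X → Prop}
    (h : ∀ y x, P (comp.mk Y X y x)) (z : (comp Y X).X) : P z :=
  Quotient.ind (fun p => h p.1 p.2) z

/-- The `(H × H', G × G')`-biset `X × Y`. -/
abbrev prod (X : Biset H G) (Y : Biset H' G') : Biset (H × H') (G × G') where
  X := X.X × Y.X
  fin := inferInstance
  l h x := (X.l h.1 x.1, Y.l h.2 x.2)
  r x g := (X.r x.1 g.1, Y.r x.2 g.2)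
  one_l := by simp [one_l]
  mul_l := by simp [mul_l]
  one_r := by simp [one_r]
  mul_r := by simp [mul_r]
  comm := by simp [comm]

/-- The relation `X ≅ Y ⊔ Z`. -/
def Rel (X Y Z : Biset H G) : Prop := Nonempty (Iso X (sum Y Z))

theorem Rel.empty : Rel (empty H G) (empty H G) (empty H G) :=
  ⟨⟨⟨Sum.inl, Sum.elim (fun x => x) (fun x => x), nofun, by rintro (x | x) <;> exact x.elim⟩,
    nofun, nofun⟩⟩

/-- `X ≅ Y ⊔ Z` from the two inclusions. -/
theorem rel_of {X Y Z : Biset H G} (i : Y.X → X.X) (j : Z.X → X.X)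
    (hil : ∀ h y, i (Y.l h y) = X.l h (i y)) (hir : ∀ y g, i (Y.r y g) = X.r (i y) g)
    (hjl : ∀ h y, j (Z.l h y) = X.l h (j y)) (hjr : ∀ y g, j (Z.r y g) = X.r (j y) g)
    (p : X.X → Y.X ⊕ Z.X) (hpi : ∀ y, p (i y) = Sum.inl y) (hpj : ∀ z, p (j z) = Sum.inr z)
    (hip : ∀ x, Sum.elim i j (p x) = x) : Rel X Y Z := by
  let e : Y.X ⊕ Z.X ≃ X.X := ⟨Sum.elim i j, p, by rintro (y | y) <;> simp [hpi, hpj], hip⟩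
  refine ⟨⟨e.symm, fun h x => ?_, fun x g => ?_⟩⟩
  · obtain ⟨y | y, rfl⟩ := e.surjective x
    · exact e.symm_apply_eq.2 (by simpa [e, sum, hpi, hpj] using (hil h y).symm)
    · exact e.symm_apply_eq.2 (by simpa [e, sum, hpi, hpj] using (hjl h y).symm)
  · obtain ⟨y | y, rfl⟩ := e.surjective x
    · exact e.symm_apply_eq.2 (by simpa [e, sum, hpi, hpj] using (hir y g).symm)
    · exact e.symm_apply_eq.2 (by simpa [e, sum, hpi, hpj] using (hjr y g).symm)

/-- The two inclusions from `X ≅ Y ⊔ Z`. -/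
theorem Rel.exists {X Y Z : Biset H G} (h : Rel X Y Z) : ∃ (i : Y.X → X.X) (j : Z.X → X.X)
    (p : X.X → Y.X ⊕ Z.X),
    (∀ h y, i (Y.l h y) = X.l h (i y)) ∧ (∀ y g, i (Y.r y g) = X.r (i y) g) ∧
    (∀ h y, j (Z.l h y) = X.l h (j y)) ∧ (∀ y g, j (Z.r y g) = X.r (j y) g) ∧
    (∀ h x, p (X.l h x) = Sum.map (Y.l h) (Z.l h) (p x)) ∧
    (∀ x g, p (X.r x g) = Sum.map (fun y => Y.r y g) (fun z => Z.r z g) (p x)) ∧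
    (∀ y, p (i y) = Sum.inl y) ∧ (∀ z, p (j z) = Sum.inr z) ∧
    (∀ x, Sum.elim i j (p x) = x) := by
  obtain ⟨e⟩ := h
  have hl : ∀ h x, e.toEquiv (X.l h x) = Sum.map (Y.l h) (Z.l h) (e.toEquiv x) := e.map_l
  have hr : ∀ x g, e.toEquiv (X.r x g) =
    Sum.map (fun y => Y.r y g) (fun z => Z.r z g) (e.toEquiv x) := e.map_r
  refine ⟨fun y => e.toEquiv.symm (Sum.inl y), fun z => e.toEquiv.symm (Sum.inr z), e.toEquiv,
    ?_, ?_, ?_, ?_, hl, hr, fun y => e.toEquiv.apply_symm_apply _,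
    fun y => e.toEquiv.apply_symm_apply _, fun x => ?_⟩
  · exact fun h y => e.toEquiv.symm_apply_eq.2 (by rw [hl, e.toEquiv.apply_symm_apply]; rfl)
  · exact fun h y => e.toEquiv.symm_apply_eq.2 (by rw [hr, e.toEquiv.apply_symm_apply]; rfl)
  · exact fun h y => e.toEquiv.symm_apply_eq.2 (by rw [hl, e.toEquiv.apply_symm_apply]; rfl)
  · exact fun h y => e.toEquiv.symm_apply_eq.2 (by rw [hr, e.toEquiv.apply_symm_apply]; rfl)
  · refine Eq.trans ?_ (e.toEquiv.symm_apply_apply x)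
    generalize e.toEquiv x = t
    cases t <;> rfl

theorem Rel.comp_right {X Y Z : Biset K H} (h : Rel X Y Z) (W : Biset H G) :
    Rel (comp X W) (comp Y W) (comp Z W) := by
  obtain ⟨i, j, p, hil, hir, hjl, hjr, hpl, hpr, hpi, hpj, hip⟩ := h.exists
  refine rel_of
    (comp.lift (fun y w => comp.mk X W (i y) w) fun y h x => by rw [hir, comp.mk_r])
    (comp.lift (fun y w => comp.mk X W (j y) w) fun y h x => by rw [hjr, comp.mk_r])
    ?_ ?_ ?_ ?_
    (comp.lift (fun x w => Sum.map (comp.mk Y W · w) (comp.mk Z W · w) (p x)) ?_) ?_ ?_ ?_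
  · exact fun h => comp.ind fun y w => congrArg (comp.mk X W · w) (hil h y)
  · exact fun y g => by induction y using comp.ind with | h y w => rfl
  · exact fun h => comp.ind fun y w => congrArg (comp.mk X W · w) (hjl h y)
  · exact fun y g => by induction y using comp.ind with | h y w => rfl
  · intro x h w
    rw [hpr]
    cases p x <;> simp [comp.mk_r]
  · exact comp.ind fun y w => congrArg (Sum.map (comp.mk Y W · w) (comp.mk Z W · w)) (hpi y)
  · exact comp.ind fun y w => congrArg (Sum.map (comp.mk Y W · w) (comp.mk Z W · w)) (hpj y)
  · refine comp.ind fun x w => ?_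
    refine Eq.trans ?_ (congrArg (comp.mk X W · w) (hip x))
    show Sum.elim _ _ (Sum.map (comp.mk Y W · w) (comp.mk Z W · w) (p x)) = _
    cases p x <;> rfl

theorem Rel.comp_left {X Y Z : Biset H G} (h : Rel X Y Z) (W : Biset K H) :
    Rel (comp W X) (comp W Y) (comp W Z) := by
  obtain ⟨i, j, p, hil, hir, hjl, hjr, hpl, hpr, hpi, hpj, hip⟩ := h.exists
  refine rel_of
    (comp.lift (fun w y => comp.mk W X w (i y)) fun y h x => by rw [hil, comp.mk_r])
    (comp.lift (fun w y => comp.mk W X w (j y)) fun y h x => by rw [hjl, comp.mk_r])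
    ?_ ?_ ?_ ?_
    (comp.lift (fun w x => Sum.map (comp.mk W Y w) (comp.mk W Z w) (p x)) ?_) ?_ ?_ ?_
  · exact fun h => comp.ind fun w y => rfl
  · exact fun y g => by
      induction y using comp.ind with | h w y => exact congrArg (comp.mk W X w) (hir y g)
  · exact fun h => comp.ind fun w y => rfl
  · exact fun y g => by
      induction y using comp.ind with | h w y => exact congrArg (comp.mk W X w) (hjr y g)
  · intro w h x
    rw [hpl]
    cases p x <;> simp [comp.mk_r]
  · exact comp.ind fun w y => congrArg (Sum.map (comp.mk W Y w) (comp.mk W Z w)) (hpi y)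
  · exact comp.ind fun w y => congrArg (Sum.map (comp.mk W Y w) (comp.mk W Z w)) (hpj y)
  · refine comp.ind fun w x => ?_
    refine Eq.trans ?_ (congrArg (comp.mk W X w) (hip x))
    show Sum.elim _ _ (Sum.map (comp.mk W Y w) (comp.mk W Z w) (p x)) = _
    cases p x <;> rfl

theorem Rel.prod_right {X Y Z : Biset H G} (h : Rel X Y Z) (W : Biset H' G') :
    Rel (prod X W) (prod Y W) (prod Z W) := by
  obtain ⟨i, j, p, hil, hir, hjl, hjr, hpl, hpr, hpi, hpj, hip⟩ := h.exists
  refine rel_of (fun y => (i y.1, y.2)) (fun y => (j y.1, y.2)) ?_ ?_ ?_ ?_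
    (fun x => Sum.map (fun y => (y, x.2)) (fun y => (y, x.2)) (p x.1)) ?_ ?_ ?_
  · exact fun h y => Prod.ext (hil _ _) rfl
  · exact fun h y => Prod.ext (hir _ _) rfl
  · exact fun h y => Prod.ext (hjl _ _) rfl
  · exact fun h y => Prod.ext (hjr _ _) rfl
  · exact fun y => by simp [hpi]
  · exact fun y => by simp [hpj]
  · rintro ⟨x, w⟩
    refine Eq.trans ?_ (congrArg (·, w) (hip x))
    dsimp only
    cases p x <;> rfl

theorem Rel.prod_left {X Y Z : Biset H G} (h : Rel X Y Z) (W : Biset H' G') :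
    Rel (prod W X) (prod W Y) (prod W Z) := by
  obtain ⟨i, j, p, hil, hir, hjl, hjr, hpl, hpr, hpi, hpj, hip⟩ := h.exists
  refine rel_of (fun y => (y.1, i y.2)) (fun y => (y.1, j y.2)) ?_ ?_ ?_ ?_
    (fun x => Sum.map (fun y => (x.1, y)) (fun y => (x.1, y)) (p x.2)) ?_ ?_ ?_
  · exact fun h y => Prod.ext rfl (hil _ _)
  · exact fun h y => Prod.ext rfl (hir _ _)
  · exact fun h y => Prod.ext rfl (hjl _ _)
  · exact fun h y => Prod.ext rfl (hjr _ _)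
  · exact fun y => by simp [hpi]
  · exact fun y => by simp [hpj]
  · rintro ⟨w, x⟩
    refine Eq.trans ?_ (congrArg (w, ·) (hip x))
    dsimp only
    cases p x <;> rfl

end

end Biset

/-- The complex vector space `ℂB(H, G) = ℂ ⊗_ℤ B(H, G)`, where `B(H, G)` is the Grothendieck group
of finite `(H, G)`-bisets for disjoint unions. It is the space of morphisms from `G` to `H` in the
biset category with complex coefficients. -/
abbrev CB (H G : Type) [Group H] [Group G] : Type 1 := CK (Biset.Rel (H := H) (G := G))

namespace CB

variable {H G K H' G' : Type} [Group H] [Group G] [Group K] [Group H'] [Group G']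

/-- The identity morphism of `G`: the class of the `(G, G)`-biset `G`. -/
def id (G : Type) [Group G] [Finite G] : CB G G := CK.of (Biset.id G)

/-- The morphism from `G` to `H` given by a group isomorphism. -/
def iso [Finite H] (f : G ≃* H) : CB H G := CK.of (Biset.iso f)

/-- The bilinear composition `ℂB(K, H) × ℂB(H, G) → ℂB(K, G)` induced by `(Y, X) ↦ Y ×_H X`. -/
def comp : CB K H →ₗ[ℂ] CB H G →ₗ[ℂ] CB K G :=
  CK.lift₂ (fun Y X => CK.of (Biset.comp Y X))
    (fun _ _ _ h X => CK.of_rel (h.comp_right X))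
    (fun Y _ _ _ h => CK.of_rel (h.comp_left Y))

/-- The bilinear map `ℂB(H, G) × ℂB(H', G') → ℂB(H × H', G × G')` induced by `(X, Y) ↦ X × Y`. -/
def prod : CB H G →ₗ[ℂ] CB H' G' →ₗ[ℂ] CB (H × H') (G × G') :=
  CK.lift₂ (fun X Y => CK.of (Biset.prod X Y))
    (fun _ _ _ h Y => CK.of_rel (h.prod_right Y))
    (fun X _ _ _ h => CK.of_rel (h.prod_left X))

end CB

/-! ## Biset functors, Green biset functors and their modules

Everything is over the field of complex numbers and on the class of all finite groups. -/

/-- A biset functor: a `ℂ`-linear functor from the biset category of all finite groups, whose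
morphisms from `G` to `H` are the elements of `ℂB(H, G)`, to complex vector spaces. -/
structure BisetFunctor where
  obj : ∀ (G : Type) [Group G] [Finite G], Type v
  [instAddCommGroup : ∀ (G : Type) [Group G] [Finite G], AddCommGroup (obj G)]
  [instModule : ∀ (G : Type) [Group G] [Finite G], Module ℂ (obj G)]
  map : ∀ {G H : Type} [Group G] [Finite G] [Group H] [Finite H],
    CB H G →ₗ[ℂ] obj G →ₗ[ℂ] obj H
  map_id : ∀ (G : Type) [Group G] [Finite G], map (CB.id G) = LinearMap.id
  map_comp : ∀ {G H K : Type} [Group G] [Finite G] [Group H] [Finite H] [Group K] [Finite K]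
    (β : CB K H) (α : CB H G), map (CB.comp β α) = map β ∘ₗ map α

attribute [instance] BisetFunctor.instAddCommGroup BisetFunctor.instModule

/-- A Green biset functor: a biset functor `A` with bilinear products `A(G) × A(H) → A(G × H)` and
an element `ε ∈ A(1)` that are associative, unital and functorial. -/
structure GreenBisetFunctor extends BisetFunctor.{v} where
  mul : ∀ {G H : Type} [Group G] [Finite G] [Group H] [Finite H],
    obj G →ₗ[ℂ] obj H →ₗ[ℂ] obj (G × H)
  one : obj Unit
  mul_assoc : ∀ {G H K : Type} [Group G] [Finite G] [Group H] [Finite H] [Group K] [Finite K]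
    (a : obj G) (b : obj H) (c : obj K),
    mul (mul a b) c =
      map (CB.iso (MulEquiv.prodAssoc : (G × H) × K ≃* G × (H × K)).symm) (mul a (mul b c))
  one_mul : ∀ {G : Type} [Group G] [Finite G] (a : obj G),
    map (CB.iso (MulEquiv.uniqueProd : Unit × G ≃* G)) (mul one a) = a
  mul_one : ∀ {G : Type} [Group G] [Finite G] (a : obj G),
    map (CB.iso (MulEquiv.prodUnique : G × Unit ≃* G)) (mul a one) = a
  map_prod : ∀ {G G' H H' : Type} [Group G] [Finite G] [Group G'] [Finite G']
    [Group H] [Finite H] [Group H'] [Finite H'] (φ : CB G' G) (ψ : CB H' H)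
    (a : obj G) (b : obj H), map (CB.prod φ ψ) (mul a b) = mul (map φ a) (map ψ b)

/-- A module over a Green biset functor `A`: a biset functor `M` with bilinear products
`A(G) × M(H) → M(G × H)` that are associative, unital and functorial. -/
structure GreenModule (A : GreenBisetFunctor.{w}) extends BisetFunctor.{v} where
  act : ∀ {G H : Type} [Group G] [Finite G] [Group H] [Finite H],
    A.obj G →ₗ[ℂ] obj H →ₗ[ℂ] obj (G × H)
  mul_act : ∀ {G H K : Type} [Group G] [Finite G] [Group H] [Finite H] [Group K] [Finite K]
    (a : A.obj G) (b : A.obj H) (m : obj K),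
    act (A.mul a b) m =
      map (CB.iso (MulEquiv.prodAssoc : (G × H) × K ≃* G × (H × K)).symm) (act a (act b m))
  one_act : ∀ {G : Type} [Group G] [Finite G] (m : obj G),
    map (CB.iso (MulEquiv.uniqueProd : Unit × G ≃* G)) (act A.one m) = m
  map_prod : ∀ {G G' H H' : Type} [Group G] [Finite G] [Group G'] [Finite G']
    [Group H] [Finite H] [Group H'] [Finite H'] (φ : CB G' G) (ψ : CB H' H)
    (a : A.obj G) (m : obj H), map (CB.prod φ ψ) (act a m) = act (A.map φ a) (map ψ m)

/-- `A` as a module over itself. -/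
def GreenBisetFunctor.self (A : GreenBisetFunctor.{v}) : GreenModule.{v} A where
  toBisetFunctor := A.toBisetFunctor
  act := A.mul
  mul_act := A.mul_assoc
  one_act := A.one_mul
  map_prod := A.map_prod

/-- A subfunctor of a biset functor. -/
structure BisetFunctor.Sub (F : BisetFunctor.{v}) where
  sub : ∀ (G : Type) [Group G] [Finite G], Submodule ℂ (F.obj G)
  map_mem : ∀ {G H : Type} [Group G] [Finite G] [Group H] [Finite H] (φ : CB H G) (x : F.obj G),
    x ∈ sub G → F.map φ x ∈ sub H

/-- The zero subfunctor. -/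
def BisetFunctor.Sub.IsZero {F : BisetFunctor.{v}} (N : F.Sub) : Prop :=
  ∀ (G : Type) [Group G] [Finite G], N.sub G = ⊥

/-- The subfunctor `F` itself. -/
def BisetFunctor.Sub.IsAll {F : BisetFunctor.{v}} (N : F.Sub) : Prop :=
  ∀ (G : Type) [Group G] [Finite G], N.sub G = ⊤

/-- `F` is not the zero functor. -/
def BisetFunctor.IsNonzero (F : BisetFunctor.{v}) : Prop :=
  ∃ (G : Type) (_ : Group G) (_ : Finite G), Nontrivial (F.obj G)

/-- A subfunctor is an `A`-submodule if it is stable under the products by elements of `A`. -/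
def GreenModule.IsSubmodule {A : GreenBisetFunctor.{w}} (M : GreenModule.{v} A)
    (N : M.toBisetFunctor.Sub) : Prop :=
  ∀ {G H : Type} [Group G] [Finite G] [Group H] [Finite H] (a : A.obj G) (m : M.obj H),
    m ∈ N.sub H → M.act a m ∈ N.sub (G × H)

/-- A simple module: it is nonzero and its only submodules are zero and itself. -/
def GreenModule.IsSimple {A : GreenBisetFunctor.{w}} (M : GreenModule.{v} A) : Prop :=
  M.IsNonzero ∧ ∀ N : M.toBisetFunctor.Sub, M.IsSubmodule N → N.IsZero ∨ N.IsAll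

/-- An isomorphism of `A`-modules: linear bijections that commute with the actions of bisets and
with the products by elements of `A`. -/
structure GreenModule.Iso {A : GreenBisetFunctor} (M : GreenModule.{v} A)
    (N : GreenModule.{w} A) where
  equiv : ∀ (G : Type) [Group G] [Finite G], M.obj G ≃ₗ[ℂ] N.obj G
  equiv_map : ∀ {G H : Type} [Group G] [Finite G] [Group H] [Finite H] (φ : CB H G)
    (m : M.obj G), equiv H (M.map φ m) = N.map φ (equiv G m)
  equiv_act : ∀ {G H : Type} [Group G] [Finite G] [Group H] [Finite H] (a : A.obj G)
    (m : M.obj H), equiv (G × H) (M.act a m) = N.act a (equiv H m)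

namespace GreenBisetFunctor

/-- A left ideal: a submodule of `A` as a module over itself. -/
def IsLeftIdeal (A : GreenBisetFunctor.{v}) (I : A.toBisetFunctor.Sub) : Prop :=
  A.self.IsSubmodule I

/-- A right ideal: a subfunctor stable under the products on the right by elements of `A`. -/
def IsRightIdeal (A : GreenBisetFunctor.{v}) (I : A.toBisetFunctor.Sub) : Prop :=
  ∀ {G H : Type} [Group G] [Finite G] [Group H] [Finite H] (x : A.obj G) (a : A.obj H),
    x ∈ I.sub G → A.mul x a ∈ I.sub (G × H)

/-- A simple Green biset functor: it is nonzero and its only two-sided ideals are zero and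
itself. -/
def IsSimple (A : GreenBisetFunctor.{v}) : Prop :=
  A.IsNonzero ∧ ∀ I : A.toBisetFunctor.Sub,
    A.IsLeftIdeal I → A.IsRightIdeal I → I.IsZero ∨ I.IsAll

end GreenBisetFunctor

/-! ## Complex representations -/

/-- A finite-dimensional complex representation of `G`, that is, a finitely generated
`ℂG`-module. -/
structure FinRep (G : Type) [Group G] where
  V : Type
  [instAddCommGroup : AddCommGroup V]
  [instModule : Module ℂ V]
  [instFinite : Module.Finite ℂ V]
  ρ : Representation ℂ G V

attribute [instance] FinRep.instAddCommGroup FinRep.instModule FinRep.instFinite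

namespace FinRep

section
variable {G H K G' H' : Type} [Group G] [Group H] [Group K] [Group G'] [Group H']

/-- There is a short exact sequence `0 → U → V → W → 0` of representations of `G`. -/
def Rel (V U W : FinRep G) : Prop :=
  ∃ (i : U.ρ.IntertwiningMap V.ρ) (p : V.ρ.IntertwiningMap W.ρ),
    Function.Injective i ∧ Function.Exact i p ∧ Function.Surjective p

/-- `V` is the direct sum of `U` and `W`. -/
def Split (V U W : FinRep G) : Prop :=
  ∃ (i : U.V →ₗ[ℂ] V.V) (j : W.V →ₗ[ℂ] V.V) (p : V.V →ₗ[ℂ] U.V) (q : V.V →ₗ[ℂ] W.V),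
    (∀ g u, i (U.ρ g u) = V.ρ g (i u)) ∧ (∀ g w, j (W.ρ g w) = V.ρ g (j w)) ∧
    (∀ g v, p (V.ρ g v) = U.ρ g (p v)) ∧ (∀ g v, q (V.ρ g v) = W.ρ g (q v)) ∧
    p ∘ₗ i = LinearMap.id ∧ q ∘ₗ j = LinearMap.id ∧ q ∘ₗ i = 0 ∧ p ∘ₗ j = 0 ∧
    i ∘ₗ p + j ∘ₗ q = LinearMap.id

theorem Split.rel {V U W : FinRep G} (h : Split V U W) : Rel V U W := by
  obtain ⟨i, j, p, q, hi, hj, hp, hq, hpi, hqj, hqi, hpj, hs⟩ := h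
  refine ⟨⟨i, fun g => LinearMap.ext (hi g)⟩, ⟨q, fun g => LinearMap.ext (hq g)⟩, ?_, ?_, ?_⟩
  · exact Function.LeftInverse.injective (g := p) fun u => LinearMap.congr_fun hpi u
  · intro v
    constructor
    · intro hv
      replace hv : q v = 0 := hv
      refine ⟨p v, ?_⟩
      have := LinearMap.congr_fun hs v
      simpa [hv] using this
    · rintro ⟨u, rfl⟩
      exact LinearMap.congr_fun hqi u
  · exact fun w => ⟨j w, LinearMap.congr_fun hqj w⟩

/-- Short exact sequences of complex representations of a finite group split. -/
theorem Rel.split [Finite G] {V U W : FinRep G} (h : Rel V U W) : Split V U W := by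
  obtain ⟨i, q, hi, hex, hq⟩ := h
  obtain ⟨p, hp⟩ : ∃ p : V.V →ₗ[ℂ] U.V, (∀ g v, p (V.ρ g v) = U.ρ g (p v)) ∧
      ∀ u, p (i u) = u := by
    cases nonempty_fintype G
    obtain ⟨r, hr⟩ := i.toLinearMap.exists_leftInverse_of_injective (LinearMap.ker_eq_bot.2 hi)
    have hr' : ∀ u, r (i u) = u := fun u => LinearMap.congr_fun hr u
    refine ⟨(Fintype.card G : ℂ)⁻¹ • ∑ g : G, U.ρ g ∘ₗ r ∘ₗ V.ρ g⁻¹, fun g v => ?_, fun u => ?_⟩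
    · simp only [LinearMap.smul_apply, LinearMap.sum_apply, LinearMap.comp_apply, map_smul, map_sum]
      congr 1
      refine Fintype.sum_equiv (Equiv.mulLeft g⁻¹) _ _ fun x => ?_
      simp only [Equiv.coe_mulLeft, ← Module.End.mul_apply, ← map_mul]
      simp
    · have : ∀ g : G, U.ρ g (r (V.ρ g⁻¹ (i u))) = u := fun g => by
        rw [← i.isIntertwining, hr', ← Module.End.mul_apply, ← map_mul]
        simp
      simp only [LinearMap.smul_apply, LinearMap.sum_apply, LinearMap.comp_apply, this]
      simp [← Nat.cast_smul_eq_nsmul ℂ, smul_smul]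
  obtain ⟨hpg, hpi⟩ := hp
  obtain ⟨t, ht⟩ := q.toLinearMap.exists_rightInverse_of_surjective (LinearMap.range_eq_top.2 hq)
  have ht' : ∀ w, q (t w) = w := fun w => LinearMap.congr_fun ht w
  have hqi : ∀ u, q (i u) = 0 := hex.apply_apply_eq_zero
  have key : ∀ v, q v = 0 → v - i (p v) = 0 := by
    intro v hv
    obtain ⟨u, rfl⟩ := (hex v).1 hv
    rw [hpi, sub_self]
  refine ⟨i.toLinearMap, t - i.toLinearMap ∘ₗ p ∘ₗ t, p, q.toLinearMap, i.isIntertwining, ?_,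
    hpg, q.isIntertwining, LinearMap.ext hpi, ?_, LinearMap.ext hqi, ?_, ?_⟩
  · intro g w
    have := key (t (W.ρ g w) - V.ρ g (t w)) (by rw [map_sub, q.isIntertwining, ht', ht', sub_self])
    rw [map_sub, map_sub, hpg, i.isIntertwining] at this
    simp only [LinearMap.sub_apply, LinearMap.comp_apply,
      Representation.IntertwiningMap.toLinearMap_apply, map_sub]
    rw [← sub_eq_zero, ← this]
    abel
  · ext w
    simp [ht', hqi]
  · ext w
    simp [hpi]
  · ext v
    have := key (v - t (q v)) (by rw [map_sub, ht', sub_self])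
    simp only [map_sub] at this
    simp only [LinearMap.sub_apply, LinearMap.comp_apply, LinearMap.add_apply, LinearMap.id_apply,
      Representation.IntertwiningMap.toLinearMap_apply]
    rw [← sub_eq_zero, ← neg_eq_zero, ← this]
    abel

/-- The zero representation. -/
abbrev zero (G : Type) [Group G] : FinRep G where
  V := PUnit
  ρ := 1

theorem of_eq_of_equiv {V W : FinRep G} (e : V.V →ₗ[ℂ] W.V) (f : W.V →ₗ[ℂ] V.V)
    (he : ∀ g v, e (V.ρ g v) = W.ρ g (e v)) (hef : e ∘ₗ f = LinearMap.id)
    (hfe : f ∘ₗ e = LinearMap.id) : (CK.of V : CK (Rel (G := G))) = CK.of W := by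
  have hf : ∀ g w, f (W.ρ g w) = V.ρ g (f w) := fun g w => by
    have h1 := LinearMap.congr_fun hef w
    have h2 := LinearMap.congr_fun hfe (V.ρ g (f w))
    simp only [LinearMap.comp_apply, LinearMap.id_apply] at h1 h2
    rw [← h2, he, h1]
  refine CK.of_eq (z := zero G) (Split.rel ⟨f, 0, e, 0, hf, ?_, he, ?_, hef, ?_, ?_, ?_, ?_⟩)
    (Split.rel ⟨0, 0, 0, 0, ?_, ?_, ?_, ?_, ?_, ?_, ?_, ?_, ?_⟩)
  all_goals simp [hfe]

/-- The external tensor product `V ⊠ W` of representations of `G` and `H`: the tensor product over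
`ℂ` of the inflations of `V` and `W` to `G × H`. -/
abbrev ext (V : FinRep G) (W : FinRep H) : FinRep (G × H) where
  V := V.V ⊗[ℂ] W.V
  ρ := Representation.tprod (V.ρ.comp (MonoidHom.fst G H)) (W.ρ.comp (MonoidHom.snd G H))

theorem ext_ρ (V : FinRep G) (W : FinRep H) (g : G × H) :
    (ext V W).ρ g = TensorProduct.map (V.ρ g.1) (W.ρ g.2) := rfl

/-- The trivial representation of dimension one of the trivial group. -/
abbrev triv : FinRep Unit where
  V := ℂ
  ρ := Representation.trivial ℂ Unit ℂ

theorem ext_map {V V' : FinRep G} {W W' : FinRep H} (f : V.V →ₗ[ℂ] V'.V) (k : W.V →ₗ[ℂ] W'.V)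
    (hf : ∀ g v, f (V.ρ g v) = V'.ρ g (f v)) (hk : ∀ g v, k (W.ρ g v) = W'.ρ g (k v))
    (g : G × H) (t : V.V ⊗[ℂ] W.V) :
    TensorProduct.map f k ((ext V W).ρ g t) = (ext V' W').ρ g (TensorProduct.map f k t) := by
  refine LinearMap.congr_fun (f := TensorProduct.map f k ∘ₗ (ext V W).ρ g)
    (g := (ext V' W').ρ g ∘ₗ TensorProduct.map f k) (TensorProduct.ext' fun v w => ?_) t
  show f (V.ρ g.1 v) ⊗ₜ k (W.ρ g.2 w) = V'.ρ g.1 (f v) ⊗ₜ W'.ρ g.2 (k w)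
  rw [hf, hk]

theorem Split.ext_right {V U W : FinRep G} (h : Split V U W) (T : FinRep H) :
    Split (ext V T) (ext U T) (ext W T) := by
  obtain ⟨i, j, p, q, hi, hj, hp, hq, hpi, hqj, hqi, hpj, hs⟩ := h
  refine ⟨i.rTensor T.V, j.rTensor T.V, p.rTensor T.V, q.rTensor T.V, ?_, ?_, ?_, ?_, ?_, ?_, ?_,
    ?_, ?_⟩
  · exact ext_map i LinearMap.id hi fun _ _ => rfl
  · exact ext_map j LinearMap.id hj fun _ _ => rfl
  · exact ext_map p LinearMap.id hp fun _ _ => rfl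
  · exact ext_map q LinearMap.id hq fun _ _ => rfl
  · exact (LinearMap.rTensor_comp T.V p i).symm.trans (by rw [hpi]; exact LinearMap.rTensor_id _ _)
  · exact (LinearMap.rTensor_comp T.V q j).symm.trans (by rw [hqj]; exact LinearMap.rTensor_id _ _)
  · exact (LinearMap.rTensor_comp T.V q i).symm.trans (by rw [hqi]; exact LinearMap.rTensor_zero _)
  · exact (LinearMap.rTensor_comp T.V p j).symm.trans (by rw [hpj]; exact LinearMap.rTensor_zero _)
  · refine (congrArg₂ (· + ·) (LinearMap.rTensor_comp T.V i p).symm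
      (LinearMap.rTensor_comp T.V j q).symm).trans ?_
    rw [← LinearMap.rTensor_add, hs]
    exact LinearMap.rTensor_id _ _

theorem Split.ext_left {V U W : FinRep G} (h : Split V U W) (T : FinRep H) :
    Split (ext T V) (ext T U) (ext T W) := by
  obtain ⟨i, j, p, q, hi, hj, hp, hq, hpi, hqj, hqi, hpj, hs⟩ := h
  refine ⟨i.lTensor T.V, j.lTensor T.V, p.lTensor T.V, q.lTensor T.V, ?_, ?_, ?_, ?_, ?_, ?_, ?_,
    ?_, ?_⟩
  · exact ext_map LinearMap.id i (fun _ _ => rfl) hi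
  · exact ext_map LinearMap.id j (fun _ _ => rfl) hj
  · exact ext_map LinearMap.id p (fun _ _ => rfl) hp
  · exact ext_map LinearMap.id q (fun _ _ => rfl) hq
  · exact (LinearMap.lTensor_comp T.V p i).symm.trans (by rw [hpi]; exact LinearMap.lTensor_id _ _)
  · exact (LinearMap.lTensor_comp T.V q j).symm.trans (by rw [hqj]; exact LinearMap.lTensor_id _ _)
  · exact (LinearMap.lTensor_comp T.V q i).symm.trans (by rw [hqi]; exact LinearMap.lTensor_zero _)
  · exact (LinearMap.lTensor_comp T.V p j).symm.trans (by rw [hpj]; exact LinearMap.lTensor_zero _)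
  · refine (congrArg₂ (· + ·) (LinearMap.lTensor_comp T.V i p).symm
      (LinearMap.lTensor_comp T.V j q).symm).trans ?_
    rw [← LinearMap.lTensor_add, hs]
    exact LinearMap.lTensor_id _ _

end

end FinRep

namespace Biset

section
variable {H G K H' G' : Type} [Group H] [Group G] [Group K] [Group H'] [Group G']

/-- The subspace of `⨁_{x ∈ X} V = ℂX ⊗_ℂ V` spanned by the elements `x · g ⊗ v - x ⊗ g · v`. -/
def tensorRel (X : Biset H G) (V : FinRep G) : Submodule ℂ (X.X →₀ V.V) :=
  Submodule.span ℂ {t | ∃ (x : X.X) (g : G) (v : V.V),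
    t = Finsupp.single (X.r x g) v - Finsupp.single x (V.ρ g v)}

/-- The vector space `ℂX ⊗_{ℂG} V`. -/
def TensorSpace (X : Biset H G) (V : FinRep G) : Type := (X.X →₀ V.V) ⧸ tensorRel X V


instance (X : Biset H G) (V : FinRep G) : AddCommGroup (TensorSpace X V) :=
  inferInstanceAs (AddCommGroup ((X.X →₀ V.V) ⧸ tensorRel X V))
instance (X : Biset H G) (V : FinRep G) : Module ℂ (TensorSpace X V) :=
  inferInstanceAs (Module ℂ ((X.X →₀ V.V) ⧸ tensorRel X V))
instance (X : Biset H G) (V : FinRep G) : Module.Finite ℂ (TensorSpace X V) :=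
  inferInstanceAs (Module.Finite ℂ ((X.X →₀ V.V) ⧸ tensorRel X V))

/-- The map `v ↦ x ⊗ v`. -/
def tmk (X : Biset H G) (V : FinRep G) (x : X.X) : V.V →ₗ[ℂ] TensorSpace X V :=
  (tensorRel X V).mkQ ∘ₗ Finsupp.lsingle x

theorem tmk_r (X : Biset H G) (V : FinRep G) (x : X.X) (g : G) (v : V.V) :
    tmk X V (X.r x g) v = tmk X V x (V.ρ g v) :=
  (Submodule.Quotient.eq _).2 (Submodule.subset_span ⟨x, g, v, rfl⟩)

/-- The linear map out of `ℂX ⊗_{ℂG} V` defined by a balanced map. -/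
def tlift {X : Biset H G} {V : FinRep G} {W : Type*} [AddCommGroup W] [Module ℂ W]
    (f : X.X → V.V →ₗ[ℂ] W) (hf : ∀ x g v, f (X.r x g) v = f x (V.ρ g v)) :
    TensorSpace X V →ₗ[ℂ] W :=
  (tensorRel X V).liftQ (Finsupp.lsum ℂ f) <| by
    refine Submodule.span_le.2 ?_
    rintro t ⟨x, g, v, rfl⟩
    refine LinearMap.mem_ker.2 ((map_sub _ _ _).trans ?_)
    rw [Finsupp.lsum_single, Finsupp.lsum_single, hf, sub_self]

@[simp]
theorem tlift_mk {X : Biset H G} {V : FinRep G} {W : Type*} [AddCommGroup W] [Module ℂ W]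
    (f : X.X → V.V →ₗ[ℂ] W) (hf : ∀ x g v, f (X.r x g) v = f x (V.ρ g v)) (x : X.X) (v : V.V) :
    tlift f hf (tmk X V x v) = f x v := by
  refine ((tensorRel X V).liftQ_apply _ _).trans ?_
  simp

theorem thom_ext {X : Biset H G} {V : FinRep G} {W : Type*} [AddCommGroup W] [Module ℂ W]
    {f f' : TensorSpace X V →ₗ[ℂ] W} (h : ∀ x v, f (tmk X V x v) = f' (tmk X V x v)) : f = f' := by
  refine Submodule.linearMap_qext _ (Finsupp.lhom_ext' fun x => LinearMap.ext fun v => h x v)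

/-- The representation `ℂX ⊗_{ℂG} V` of `H`, for an `(H, G)`-biset `X` and a representation `V`
of `G`; `H` acts by `h · (x ⊗ v) = (h · x) ⊗ v`. -/
abbrev tensor (X : Biset H G) (V : FinRep G) : FinRep H where
  V := TensorSpace X V
  ρ :=
    { toFun := fun h => tlift (fun x => tmk X V (X.l h x))
        fun x g v => by rw [← X.comm, tmk_r]
      map_one' := thom_ext fun x v => by simp [X.one_l]
      map_mul' := fun h h' => thom_ext fun x v => by simp [X.mul_l] }

@[simp]
theorem tensor_ρ_mk (X : Biset H G) (V : FinRep G) (h : H) (x : X.X) (v : V.V) :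
    (tensor X V).ρ h (tmk X V x v) = tmk X V (X.l h x) v :=
  tlift_mk (fun x => tmk X V (X.l h x)) (fun x g v => by rw [← X.comm, tmk_r]) x v

/-- The map `ℂX ⊗_{ℂG} V → ℂX ⊗_{ℂG} W` induced by a map `V → W` of representations. -/
def tensorMap (X : Biset H G) {V W : FinRep G} (f : V.V →ₗ[ℂ] W.V)
    (hf : ∀ g v, f (V.ρ g v) = W.ρ g (f v)) : TensorSpace X V →ₗ[ℂ] TensorSpace X W :=
  tlift (fun x => tmk X W x ∘ₗ f) fun x g v => by simp [hf, tmk_r]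

@[simp]
theorem tensorMap_mk (X : Biset H G) {V W : FinRep G} (f : V.V →ₗ[ℂ] W.V)
    (hf : ∀ g v, f (V.ρ g v) = W.ρ g (f v)) (x : X.X) (v : V.V) :
    tensorMap X f hf (tmk X V x v) = tmk X W x (f v) :=
  tlift_mk _ _ _ _

theorem tensorMap_ρ (X : Biset H G) {V W : FinRep G} (f : V.V →ₗ[ℂ] W.V)
    (hf : ∀ g v, f (V.ρ g v) = W.ρ g (f v)) (h : H) (t : TensorSpace X V) :
    tensorMap X f hf ((tensor X V).ρ h t) = (tensor X W).ρ h (tensorMap X f hf t) :=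
  LinearMap.congr_fun (f := tensorMap X f hf ∘ₗ (tensor X V).ρ h)
    (g := (tensor X W).ρ h ∘ₗ tensorMap X f hf)
    (thom_ext fun x v => by
      simp only [LinearMap.comp_apply]
      rw [tensor_ρ_mk, tensorMap_mk, tensorMap_mk, tensor_ρ_mk]) t

theorem split_tensor_left (X : Biset H G) {V U W : FinRep G} (h : FinRep.Split V U W) :
    FinRep.Split (tensor X V) (tensor X U) (tensor X W) := by
  obtain ⟨i, j, p, q, hi, hj, hp, hq, hpi, hqj, hqi, hpj, hs⟩ := h
  refine ⟨tensorMap X i hi, tensorMap X j hj, tensorMap X p hp, tensorMap X q hq,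
    tensorMap_ρ X i hi, tensorMap_ρ X j hj, tensorMap_ρ X p hp, tensorMap_ρ X q hq,
    ?_, ?_, ?_, ?_, ?_⟩
  · refine thom_ext fun x v => ?_
    have := LinearMap.congr_fun hpi v
    simp only [LinearMap.comp_apply, LinearMap.id_apply] at this
    simp only [LinearMap.comp_apply, tensorMap_mk, this, LinearMap.id_apply]
  · refine thom_ext fun x v => ?_
    have := LinearMap.congr_fun hqj v
    simp only [LinearMap.comp_apply, LinearMap.id_apply] at this
    simp only [LinearMap.comp_apply, tensorMap_mk, this, LinearMap.id_apply]
  · refine thom_ext fun x v => ?_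
    have := LinearMap.congr_fun hqi v
    simp only [LinearMap.comp_apply, LinearMap.zero_apply] at this
    simp only [LinearMap.comp_apply, tensorMap_mk, this, LinearMap.zero_apply, map_zero]
  · refine thom_ext fun x v => ?_
    have := LinearMap.congr_fun hpj v
    simp only [LinearMap.comp_apply, LinearMap.zero_apply] at this
    simp only [LinearMap.comp_apply, tensorMap_mk, this, LinearMap.zero_apply, map_zero]
  · refine thom_ext fun x v => ?_
    have := LinearMap.congr_fun hs v
    simp only [LinearMap.add_apply, LinearMap.comp_apply, LinearMap.id_apply] at this
    simp only [LinearMap.add_apply, LinearMap.comp_apply, LinearMap.id_apply, tensorMap_mk,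
      ← map_add, this]

theorem split_tensor_right {X Y Z : Biset H G} (h : Rel X Y Z) (V : FinRep G) :
    FinRep.Split (tensor X V) (tensor Y V) (tensor Z V) := by
  obtain ⟨i, j, p, hil, hir, hjl, hjr, hpl, hpr, hpi, hpj, hip⟩ := h.exists
  let I : TensorSpace Y V →ₗ[ℂ] TensorSpace X V :=
    tlift (fun y => tmk X V (i y)) fun y g v => by rw [hir, tmk_r]
  let J : TensorSpace Z V →ₗ[ℂ] TensorSpace X V :=
    tlift (fun y => tmk X V (j y)) fun y g v => by rw [hjr, tmk_r]
  let P : TensorSpace X V →ₗ[ℂ] TensorSpace Y V :=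
    tlift (fun x => Sum.elim (fun y => tmk Y V y) (fun _ => 0) (p x)) fun x g v => by
      rw [hpr]; cases p x <;> simp [tmk_r]
  let Q : TensorSpace X V →ₗ[ℂ] TensorSpace Z V :=
    tlift (fun x => Sum.elim (fun _ => 0) (fun y => tmk Z V y) (p x)) fun x g v => by
      rw [hpr]; cases p x <;> simp [tmk_r]
  have hI : ∀ y v, I (tmk Y V y v) = tmk X V (i y) v := fun y v => tlift_mk _ _ _ _
  have hJ : ∀ y v, J (tmk Z V y v) = tmk X V (j y) v := fun y v => tlift_mk _ _ _ _
  have hP : ∀ x v, P (tmk X V x v) = Sum.elim (fun y => tmk Y V y) (fun _ => 0) (p x) v :=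
    fun y v => tlift_mk _ _ _ _
  have hQ : ∀ x v, Q (tmk X V x v) = Sum.elim (fun _ => 0) (fun y => tmk Z V y) (p x) v :=
    fun y v => tlift_mk _ _ _ _
  refine ⟨I, J, P, Q, ?_, ?_, ?_, ?_, ?_, ?_, ?_, ?_, ?_⟩
  · refine fun h => LinearMap.congr_fun (f := I ∘ₗ (tensor Y V).ρ h)
      (g := (tensor X V).ρ h ∘ₗ I) (thom_ext fun x v => ?_)
    simp only [LinearMap.comp_apply]
    rw [tensor_ρ_mk, hI, hI, tensor_ρ_mk, hil]
  · refine fun h => LinearMap.congr_fun (f := J ∘ₗ (tensor Z V).ρ h)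
      (g := (tensor X V).ρ h ∘ₗ J) (thom_ext fun x v => ?_)
    simp only [LinearMap.comp_apply]
    rw [tensor_ρ_mk, hJ, hJ, tensor_ρ_mk, hjl]
  · refine fun h => LinearMap.congr_fun (f := P ∘ₗ (tensor X V).ρ h)
      (g := (tensor Y V).ρ h ∘ₗ P) (thom_ext fun x v => ?_)
    simp only [LinearMap.comp_apply]
    rw [tensor_ρ_mk, hP, hP, hpl]
    cases p x
    · exact (tensor_ρ_mk Y V h _ v).symm
    · exact (map_zero ((tensor Y V).ρ h)).symm
  · refine fun h => LinearMap.congr_fun (f := Q ∘ₗ (tensor X V).ρ h)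
      (g := (tensor Z V).ρ h ∘ₗ Q) (thom_ext fun x v => ?_)
    simp only [LinearMap.comp_apply]
    rw [tensor_ρ_mk, hQ, hQ, hpl]
    cases p x
    · exact (map_zero ((tensor Z V).ρ h)).symm
    · exact (tensor_ρ_mk Z V h _ v).symm
  · refine thom_ext fun x v => ?_
    simp only [LinearMap.comp_apply, hI, hP, hpi]; rfl
  · refine thom_ext fun x v => ?_
    simp only [LinearMap.comp_apply, hJ, hQ, hpj]; rfl
  · refine thom_ext fun x v => ?_
    simp only [LinearMap.comp_apply, hI, hQ, hpi]; rfl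
  · refine thom_ext fun x v => ?_
    simp only [LinearMap.comp_apply, hJ, hP, hpj]; rfl
  · refine thom_ext fun x v => ?_
    have hx := hip x
    simp only [LinearMap.add_apply, LinearMap.comp_apply, hP, hQ, LinearMap.id_apply]
    cases h : p x with
    | inl y =>
      rw [h] at hx
      simp only [Sum.elim_inl, hI, LinearMap.zero_apply, map_zero, add_zero] at hx ⊢
      rw [hx]
    | inr y =>
      rw [h] at hx
      simp only [Sum.elim_inr, hJ, LinearMap.zero_apply, map_zero, zero_add] at hx ⊢
      rw [hx]

end

end Biset

/-- The complex vector space `ℂR_ℂ(G) = ℂ ⊗_ℤ R_ℂ(G)`, where `R_ℂ(G)` is the Grothendieck group of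
finitely generated `ℂG`-modules. -/
abbrev CR (G : Type) [Group G] : Type 1 := CK (FinRep.Rel (G := G))

namespace CR

open Biset (tmk tmk_r tlift tlift_mk thom_ext)

variable {H G K H' G' : Type} [Group H] [Group G] [Group K] [Group H'] [Group G']

/-- The bilinear action of bisets on representations, induced by `(X, V) ↦ ℂX ⊗_{ℂG} V`. -/
def map [Finite G] : CB H G →ₗ[ℂ] CR G →ₗ[ℂ] CR H :=
  CK.lift₂ (fun X V => CK.of (Biset.tensor X V))
    (fun _ _ _ h V => CK.of_rel (Biset.split_tensor_right h V).rel)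
    (fun X _ _ _ h => CK.of_rel (Biset.split_tensor_left X h.split).rel)

/-- The bilinear product `ℂR_ℂ(G) × ℂR_ℂ(H) → ℂR_ℂ(G × H)` induced by `(V, W) ↦ V ⊠ W`. -/
def mul [Finite G] [Finite H] : CR G →ₗ[ℂ] CR H →ₗ[ℂ] CR (G × H) :=
  CK.lift₂ (fun V W => CK.of (FinRep.ext V W))
    (fun _ _ _ h W => CK.of_rel (h.split.ext_right W).rel)
    (fun V _ _ _ h => CK.of_rel (h.split.ext_left V).rel)

@[simp]
theorem map_of [Finite G] (X : Biset H G) (V : FinRep G) :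
    map (CK.of X) (CK.of V) = CK.of (Biset.tensor X V) := CK.lift₂_of _ _ _ _ _

@[simp]
theorem mul_of [Finite G] [Finite H] (V : FinRep G) (W : FinRep H) :
    mul (CK.of V) (CK.of W) = CK.of (FinRep.ext V W) := CK.lift₂_of _ _ _ _ _

/-- `ℂ Iso(f) ⊗_{ℂG} V ≅ W` if `V` and `W` correspond to each other along `f`. -/
theorem tensor_iso [Finite H] (f : G ≃* H) (V : FinRep G) (W : FinRep H)
    (e : V.V →ₗ[ℂ] W.V) (e' : W.V →ₗ[ℂ] V.V) (he : ∀ g v, e (V.ρ g v) = W.ρ (f g) (e v))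
    (h1 : ∀ w, e (e' w) = w) (h2 : ∀ v, e' (e v) = v) :
    (CK.of (Biset.tensor (Biset.iso f) V) : CR H) = CK.of W := by
  let E : Biset.TensorSpace (Biset.iso f) V →ₗ[ℂ] W.V :=
    tlift (fun (x : H) => W.ρ x ∘ₗ e) fun (x : H) g v => by
      show W.ρ (x * f g) (e v) = W.ρ x (e (V.ρ g v))
      rw [he, map_mul]; rfl
  have hE : ∀ x v, E (tmk _ V x v) = W.ρ x (e v) := fun x v => tlift_mk _ _ _ _
  refine FinRep.of_eq_of_equiv E (tmk (Biset.iso f) V (1 : H) ∘ₗ e') ?_ ?_ ?_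
  · refine fun h => LinearMap.congr_fun (f := E ∘ₗ (Biset.tensor (Biset.iso f) V).ρ h)
      (g := W.ρ h ∘ₗ E) (thom_ext fun x v => ?_)
    simp only [LinearMap.comp_apply]
    rw [Biset.tensor_ρ_mk, hE, hE]
    show W.ρ (h * x) (e v) = _
    rw [map_mul]; rfl
  · refine LinearMap.ext fun w => ?_
    simp only [LinearMap.comp_apply, hE]
    rw [map_one, h1]; rfl
  · refine thom_ext fun (x : H) v => ?_
    simp only [LinearMap.comp_apply, hE]
    obtain ⟨g, rfl⟩ := f.surjective x
    rw [← he, h2, ← tmk_r]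
    exact congrArg (fun t => tmk (Biset.iso f) V t v) (_root_.one_mul (f g))

theorem tensor_comp (Y : Biset K H) (X : Biset H G) (V : FinRep G) :
    (CK.of (Biset.tensor (Biset.comp Y X) V) : CR K) =
      CK.of (Biset.tensor Y (Biset.tensor X V)) := by
  let E : Biset.TensorSpace (Biset.comp Y X) V →ₗ[ℂ]
      Biset.TensorSpace Y (Biset.tensor X V) :=
    tlift (Biset.comp.lift (fun y x => tmk Y (Biset.tensor X V) y ∘ₗ tmk X V x) fun y h x => by
        refine LinearMap.ext fun v => ?_
        simp only [LinearMap.comp_apply]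
        rw [tmk_r, Biset.tensor_ρ_mk])
      fun z g v => by
        induction z using Biset.comp.ind with | h y x => ?_
        exact congrArg (tmk Y (Biset.tensor X V) y) (tmk_r X V x g v)
  let F1 (y : Y.X) : Biset.TensorSpace X V →ₗ[ℂ] Biset.TensorSpace (Biset.comp Y X) V :=
    tlift (fun x => tmk (Biset.comp Y X) V (Biset.comp.mk Y X y x))
      fun x g v => tmk_r (Biset.comp Y X) V (Biset.comp.mk Y X y x) g v
  have hF1 : ∀ y x v, F1 y (tmk X V x v) = tmk (Biset.comp Y X) V (Biset.comp.mk Y X y x) v :=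
    fun y x v => tlift_mk _ _ _ _
  let F : Biset.TensorSpace Y (Biset.tensor X V) →ₗ[ℂ] Biset.TensorSpace (Biset.comp Y X) V :=
    tlift F1 fun y h => LinearMap.congr_fun (f := F1 (Y.r y h))
      (g := F1 y ∘ₗ (Biset.tensor X V).ρ h) (thom_ext fun x v => by
        rw [LinearMap.comp_apply, Biset.tensor_ρ_mk, hF1, hF1, Biset.comp.mk_r])
  have hE : ∀ y x v, E (tmk (Biset.comp Y X) V (Biset.comp.mk Y X y x) v) =
      tmk Y (Biset.tensor X V) y (tmk X V x v) := fun y x v => tlift_mk _ _ _ _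
  have hF : ∀ y x v, F (tmk Y (Biset.tensor X V) y (tmk X V x v)) =
      tmk (Biset.comp Y X) V (Biset.comp.mk Y X y x) v :=
    fun y x v => (tlift_mk _ _ _ _).trans (hF1 y x v)
  refine FinRep.of_eq_of_equiv E F ?_ ?_ ?_
  · refine fun k => LinearMap.congr_fun (f := E ∘ₗ (Biset.tensor (Biset.comp Y X) V).ρ k)
      (g := (Biset.tensor Y (Biset.tensor X V)).ρ k ∘ₗ E) (thom_ext fun z v => ?_)
    induction z using Biset.comp.ind with | h y x => ?_
    simp only [LinearMap.comp_apply]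
    rw [Biset.tensor_ρ_mk, hE, Biset.tensor_ρ_mk]
    exact hE (Y.l k y) x v
  · refine thom_ext fun y t => ?_
    refine LinearMap.congr_fun (f := (E ∘ₗ F) ∘ₗ tmk Y (Biset.tensor X V) y)
      (g := LinearMap.id ∘ₗ tmk Y (Biset.tensor X V) y) (thom_ext fun x v => ?_) t
    simp only [LinearMap.comp_apply, LinearMap.id_apply]
    rw [hF, hE]
  · refine thom_ext fun z v => ?_
    induction z using Biset.comp.ind with | h y x => ?_
    simp only [LinearMap.comp_apply, LinearMap.id_apply]
    rw [hE, hF]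

theorem tensor_prod (X : Biset H G) (Y : Biset H' G') (V : FinRep G) (W : FinRep G') :
    (CK.of (Biset.tensor (Biset.prod X Y) (FinRep.ext V W)) : CR (H × H')) =
      CK.of (FinRep.ext (Biset.tensor X V) (Biset.tensor Y W)) := by
  let P := Biset.prod X Y
  let U := FinRep.ext V W
  let E : Biset.TensorSpace P U →ₗ[ℂ] Biset.TensorSpace X V ⊗[ℂ] Biset.TensorSpace Y W :=
    tlift (fun z => TensorProduct.map (tmk X V z.1) (tmk Y W z.2)) fun z g t => by
      refine LinearMap.congr_fun
        (f := TensorProduct.map (tmk X V (X.r z.1 g.1)) (tmk Y W (Y.r z.2 g.2)))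
        (g := TensorProduct.map (tmk X V z.1) (tmk Y W z.2) ∘ₗ U.ρ g)
        (TensorProduct.ext' fun v w => ?_) t
      rw [TensorProduct.map_tmul, tmk_r, tmk_r]
      rfl
  let F0 : Biset.TensorSpace X V →ₗ[ℂ] Biset.TensorSpace Y W →ₗ[ℂ] Biset.TensorSpace P U :=
    tlift (fun x => LinearMap.flip <| tlift (fun y => LinearMap.flip <|
        (TensorProduct.mk ℂ V.V W.V).compr₂ (tmk P U (x, y))) fun y g w =>
          LinearMap.ext fun v => by
            have := tmk_r P U (x, y) (1, g) (v ⊗ₜ w)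
            rw [FinRep.ext_ρ, TensorProduct.map_tmul, map_one] at this
            refine Eq.trans ?_ this
            exact congrArg (fun t => tmk P U (t, Y.r y g) (v ⊗ₜ w)) (X.one_r x).symm)
      fun x g v => by
        refine thom_ext fun y w => ?_
        simp only [LinearMap.flip_apply, tlift_mk]
        have := tmk_r P U (x, y) (g, 1) (v ⊗ₜ w)
        rw [FinRep.ext_ρ, TensorProduct.map_tmul, map_one] at this
        refine Eq.trans ?_ this
        exact congrArg (fun t => tmk P U (X.r x g, t) (v ⊗ₜ w)) (Y.one_r y).symm
  let F : Biset.TensorSpace X V ⊗[ℂ] Biset.TensorSpace Y W →ₗ[ℂ] Biset.TensorSpace P U :=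
    TensorProduct.lift F0
  have hE : ∀ x y v w, E (tmk P U (x, y) (v ⊗ₜ w)) = tmk X V x v ⊗ₜ tmk Y W y w :=
    fun x y v w => tlift_mk _ _ _ _
  have hF : ∀ x y v w, F (tmk X V x v ⊗ₜ tmk Y W y w) = tmk P U (x, y) (v ⊗ₜ w) :=
    fun x y v w => by
      refine (TensorProduct.lift.tmul _ _).trans ?_
      simp only [F0, tlift_mk, LinearMap.flip_apply]
      rfl
  have ext1 : ∀ {T : Type} [AddCommGroup T] [Module ℂ T]
      {f g : Biset.TensorSpace P U →ₗ[ℂ] T}, (∀ x y v w, f (tmk P U (x, y) (v ⊗ₜ w)) =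
        g (tmk P U (x, y) (v ⊗ₜ w))) → f = g := fun {T} _ _ {f g} h =>
    thom_ext fun z t => LinearMap.congr_fun (f := f ∘ₗ tmk P U z) (g := g ∘ₗ tmk P U z)
      (TensorProduct.ext' fun v w => h z.1 z.2 v w) t
  refine FinRep.of_eq_of_equiv E F ?_ ?_ ?_
  · refine fun h => LinearMap.congr_fun (f := E ∘ₗ (Biset.tensor P U).ρ h)
      (g := (FinRep.ext (Biset.tensor X V) (Biset.tensor Y W)).ρ h ∘ₗ E)
      (ext1 fun x y v w => ?_)
    rw [LinearMap.comp_apply, LinearMap.comp_apply, Biset.tensor_ρ_mk, hE, hE]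
    refine Eq.trans ?_ (TensorProduct.map_tmul ((Biset.tensor X V).ρ h.1)
      ((Biset.tensor Y W).ρ h.2) _ _).symm
    rw [Biset.tensor_ρ_mk, Biset.tensor_ρ_mk]
  · refine TensorProduct.ext' fun s t => ?_
    have : ((TensorProduct.mk ℂ _ _).compr₂ (E ∘ₗ F) :
        Biset.TensorSpace X V →ₗ[ℂ] Biset.TensorSpace Y W →ₗ[ℂ] _) =
        TensorProduct.mk ℂ _ _ :=
      thom_ext fun x v => thom_ext fun y w => by
        simp only [LinearMap.compr₂_apply, TensorProduct.mk_apply, LinearMap.comp_apply]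
        rw [hF, hE]
    exact LinearMap.congr_fun (LinearMap.congr_fun this s) t
  · refine ext1 fun x y v w => ?_
    simp only [LinearMap.comp_apply, LinearMap.id_apply]
    rw [hE, hF]

variable [Finite G] [Finite H] [Finite H'] [Finite G']

theorem map_id (a : CR G) : map (CB.id G) a = a := by
  induction a using CK.induction with
  | of V =>
    exact (map_of _ _).trans (tensor_iso _ V V LinearMap.id LinearMap.id (fun _ _ => rfl)
      (fun _ => rfl) fun _ => rfl)
  | zero => exact map_zero _
  | add x y hx hy => rw [map_add, hx, hy]
  | smul z x hx => rw [map_smul, hx]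

theorem map_comp (β : CB K H) (α : CB H G) (a : CR G) :
    map (CB.comp β α) a = map β (map α a) := by
  induction β using CK.induction with
  | of Y =>
    induction α using CK.induction with
    | of X =>
      induction a using CK.induction with
      | of V => simp only [CB.comp, CK.lift₂_of, map_of, tensor_comp]
      | zero => simp only [map_zero]
      | add x y hx hy => simp only [map_add, hx, hy]
      | smul z x hx => simp only [map_smul, hx]
    | zero => simp only [map_zero, LinearMap.zero_apply]
    | add x y hx hy => simp only [map_add, LinearMap.add_apply, hx, hy]
    | smul z x hx => simp only [map_smul, LinearMap.smul_apply, hx]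
  | zero => simp only [map_zero, LinearMap.zero_apply]
  | add x y hx hy => simp only [map_add, LinearMap.add_apply, hx, hy]
  | smul z x hx => simp only [map_smul, LinearMap.smul_apply, hx]

theorem mul_assoc [Finite K] (a : CR G) (b : CR H) (c : CR K) :
    mul (mul a b) c =
      map (CB.iso (MulEquiv.prodAssoc : (G × H) × K ≃* G × (H × K)).symm) (mul a (mul b c)) := by
  induction a using CK.induction with
  | of U =>
    induction b using CK.induction with
    | of V =>
      induction c using CK.induction with
      | of W =>
        simp only [mul_of, CB.iso, map_of]
        let e := TensorProduct.assoc ℂ U.V V.V W.V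
        refine (tensor_iso _ (FinRep.ext U (FinRep.ext V W)) (FinRep.ext (FinRep.ext U V) W)
          e.symm.toLinearMap e.toLinearMap ?_ (fun w => e.symm_apply_apply w)
          fun v => e.apply_symm_apply v).symm
        refine fun g => LinearMap.congr_fun
          (f := e.symm.toLinearMap ∘ₗ (FinRep.ext U (FinRep.ext V W)).ρ g)
          (g := (FinRep.ext (FinRep.ext U V) W).ρ ((g.1, g.2.1), g.2.2) ∘ₗ e.symm.toLinearMap) ?_
        exact TensorProduct.ext_threefold' fun u v w => rfl
      | zero => simp only [map_zero]
      | add x y hx hy => simp only [map_add, hx, hy]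
      | smul z x hx => simp only [map_smul, hx]
    | zero => simp only [map_zero, LinearMap.zero_apply]
    | add x y hx hy => simp only [map_add, LinearMap.add_apply, hx, hy]
    | smul z x hx => simp only [map_smul, LinearMap.smul_apply, hx]
  | zero => simp only [map_zero, LinearMap.zero_apply]
  | add x y hx hy => simp only [map_add, LinearMap.add_apply, hx, hy]
  | smul z x hx => simp only [map_smul, LinearMap.smul_apply, hx]

theorem one_mul (a : CR G) :
    map (CB.iso (MulEquiv.uniqueProd : Unit × G ≃* G)) (mul (CK.of FinRep.triv) a) = a := by
  induction a using CK.induction with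
  | of V =>
    simp only [mul_of, CB.iso, map_of]
    let e := TensorProduct.lid ℂ V.V
    refine tensor_iso _ (FinRep.ext FinRep.triv V) V e.toLinearMap e.symm.toLinearMap ?_
      (fun w => e.apply_symm_apply w) fun v => e.symm_apply_apply v
    refine fun g => LinearMap.congr_fun
      (f := e.toLinearMap ∘ₗ (FinRep.ext FinRep.triv V).ρ g) (g := V.ρ g.2 ∘ₗ e.toLinearMap)
      (TensorProduct.ext' fun (z : ℂ) v => ?_)
    exact (map_smul (V.ρ g.2) z v).symm
  | zero => simp only [map_zero]
  | add x y hx hy => simp only [map_add, hx, hy]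
  | smul z x hx => simp only [map_smul, hx]

theorem mul_one (a : CR G) :
    map (CB.iso (MulEquiv.prodUnique : G × Unit ≃* G)) (mul a (CK.of FinRep.triv)) = a := by
  induction a using CK.induction with
  | of V =>
    simp only [mul_of, CB.iso, map_of]
    let e := TensorProduct.rid ℂ V.V
    refine tensor_iso _ (FinRep.ext V FinRep.triv) V e.toLinearMap e.symm.toLinearMap ?_
      (fun w => e.apply_symm_apply w) fun v => e.symm_apply_apply v
    refine fun g => LinearMap.congr_fun
      (f := e.toLinearMap ∘ₗ (FinRep.ext V FinRep.triv).ρ g) (g := V.ρ g.1 ∘ₗ e.toLinearMap)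
      (TensorProduct.ext' fun v (z : ℂ) => ?_)
    exact (map_smul (V.ρ g.1) z v).symm
  | zero => simp only [map_zero, LinearMap.zero_apply]
  | add x y hx hy => simp only [map_add, LinearMap.add_apply, hx, hy]
  | smul z x hx => simp only [map_smul, LinearMap.smul_apply, hx]

theorem map_prod (φ : CB H G) (ψ : CB H' G') (a : CR G) (b : CR G') :
    map (CB.prod φ ψ) (mul a b) = mul (map φ a) (map ψ b) := by
  induction φ using CK.induction with
  | of X =>
    induction ψ using CK.induction with
    | of Y =>
      induction a using CK.induction with
      | of V =>
        induction b using CK.induction with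
        | of W => simp only [CB.prod, CK.lift₂_of, map_of, mul_of, tensor_prod]
        | zero => simp only [map_zero]
        | add x y hx hy => simp only [map_add, hx, hy]
        | smul z x hx => simp only [map_smul, hx]
      | zero => simp only [map_zero, LinearMap.zero_apply]
      | add x y hx hy => simp only [map_add, LinearMap.add_apply, hx, hy]
      | smul z x hx => simp only [map_smul, LinearMap.smul_apply, hx]
    | zero => simp only [map_zero, LinearMap.zero_apply]
    | add x y hx hy => simp only [map_add, LinearMap.add_apply, hx, hy]
    | smul z x hx => simp only [map_smul, LinearMap.smul_apply, hx]
  | zero => simp only [map_zero, LinearMap.zero_apply]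
  | add x y hx hy => simp only [map_add, LinearMap.add_apply, hx, hy]
  | smul z x hx => simp only [map_smul, LinearMap.smul_apply, hx]

end CR

/-- The Green biset functor `ℂR_ℂ` of complex representations, with coefficients extended to `ℂ`:
an `(H, G)`-biset `X` sends the class of `V` to the class of `ℂX ⊗_{ℂG} V`, the product of the
classes of `V` and `W` is the class of `V ⊠ W`, and the unit is the class of the trivial
representation of the trivial group. -/
def complexRep : GreenBisetFunctor.{1} where
  obj G _ _ := CR G
  map := CR.map
  map_id _ _ _ := LinearMap.ext CR.map_id
  map_comp β α := LinearMap.ext (CR.map_comp β α)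
  mul := CR.mul
  one := CK.of FinRep.triv
  mul_assoc := CR.mul_assoc
  one_mul := CR.one_mul
  mul_one := CR.mul_one
  map_prod := CR.map_prod

end GreenBiset

end

/-! Every finite group `G` is its own dual in the biset category. The set `G`, seen as a `(G × G,
1)`-biset and as a `(1, G × G)`-biset, gives a coevaluation and an evaluation that satisfy a
triangle identity (`Biset.triangle`).

Let `M` be a module over a Green biset functor `A`, let `m ∈ M(G)`, and let `c ∈ A(G × G)` be the
image of `ε` under the coevaluation. The triangle identity says that `m` is recovered from `c × m`
by evaluating the last two factors. If `c = ∑ aᵢ × bᵢ`, this reads `m = ∑ aᵢ × ev(bᵢ × m)`, up to `G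
× 1 ≅ G`, so `m` vanishes as soon as all the elements `ev(b × m)` of `M(1)` do
(`GreenModule.eq_zero_of_map_ev_act_eq_zero`). Hence a nonzero module, or a nonzero submodule, is
already nonzero at the trivial group.

For `ℂR_ℂ` the element `c` is the class of `ℂG` as a representation of `G × G`. The Wedderburn
decomposition of `ℂG` into matrix algebras `Vᵢ ⊗ Vᵢ*` writes `c` as a sum of products
(`FinRep.tensor_coev_mem_span`).

Since `ℂR_ℂ(1) = ℂ ε`, a nonzero submodule of `ℂR_ℂ` contains `ε`, hence every `a = a × ε`; so
`ℂR_ℂ` is simple over itself, and a fortiori has no proper nonzero two-sided ideal. If `M` is a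
simple module, choose `m ≠ 0` in `M(1)`. The morphism `a ↦ a × m` from `ℂR_ℂ` to `M` sends `ε` to
`m`, so it is nonzero between simple modules, hence an isomorphism
(`GreenModule.nonempty_iso_self`). -/

noncomputable section

namespace GreenBiset

/-! ### Computing composites in the biset category. -/

namespace Biset

variable {H G K L : Type} [Group H] [Group G] [Group K] [Group L]

/-- The defining relations only speak of disjoint unions, so an isomorphism is read as `X ≅ Y ⊔ ∅`;
the class of `∅` vanishes because `∅ ≅ ∅ ⊔ ∅`. -/
theorem of_eq_of_bijective {X Y : Biset H G} (f : X.X → Y.X) (hf : Function.Bijective f)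
    (hl : ∀ h x, f (X.l h x) = Y.l h (f x)) (hr : ∀ x g, f (X.r x g) = Y.r (f x) g) :
    (CK.of X : CB H G) = CK.of Y := by
  obtain ⟨e, he, he'⟩ := Function.bijective_iff_has_inverse.1 hf
  refine CK.of_eq (z := empty H G) (rel_of e Empty.elim ?_ ?_ nofun nofun
    (fun x => Sum.inl (f x)) ?_ nofun he) Rel.empty
  · exact fun h y => hf.1 (by rw [he', hl, he'])
  · exact fun y g => hf.1 (by rw [he', hr, he'])
  · exact fun y => congrArg Sum.inl (he' y)

/-- The class of `Y ×_H X`, computed by a balanced equivariant map to `Z` with a section `s`. -/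
theorem comp_of_eq_of {Y : Biset K H} {X : Biset H G} {Z : Biset K G} (f : Y.X → X.X → Z.X)
    (hf : ∀ y h x, f (Y.r y h) x = f y (X.l h x)) (hl : ∀ k y x, f (Y.l k y) x = Z.l k (f y x))
    (hr : ∀ y x g, f y (X.r x g) = Z.r (f y x) g) (s : Z.X → Y.X × X.X)
    (hs : ∀ z, f (s z).1 (s z).2 = z)
    (hs' : ∀ y x, ∃ h : H, s (f y x) = (Y.r y h, X.l h⁻¹ x)) :
    CB.comp (CK.of Y) (CK.of X) = CK.of Z := by
  rw [CB.comp, CK.lift₂_of]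
  refine of_eq_of_bijective (comp.lift f hf) ?_ ?_ ?_
  · refine Function.bijective_iff_has_inverse.2 ⟨fun z => comp.mk Y X (s z).1 (s z).2, ?_, hs⟩
    refine comp.ind fun y x => ?_
    -- By `hs'` the section returns a pair in the `H`-orbit of `(y, x)`, which makes the induced map
    -- injective on the quotient.
    obtain ⟨h, hh⟩ := hs' y x
    show comp.mk Y X (s (f y x)).1 (s (f y x)).2 = _
    rw [hh, comp.mk_r, ← mul_l, mul_inv_cancel, one_l]
  · exact fun k => comp.ind (hl k)
  · exact fun z g => by induction z using comp.ind with | h y x => exact hr y x g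

/-- Transport of the left action along a homomorphism. -/
abbrev resL (f : K →* H) (X : Biset H G) : Biset K G where
  X := X.X
  fin := X.fin
  l k x := X.l (f k) x
  r := X.r
  one_l := by simp [one_l]
  mul_l := by simp [mul_l]
  one_r := X.one_r
  mul_r := X.mul_r
  comm _ := X.comm _

/-- Transport of the right action along a homomorphism. -/
abbrev resR (f : K →* G) (X : Biset H G) : Biset H K where
  X := X.X
  fin := X.fin
  l := X.l
  r x k := X.r x (f k)
  one_l := X.one_l
  mul_l := X.mul_l
  one_r := by simp [one_r]
  mul_r := by simp [mul_r]
  comm _ _ _ := X.comm _ _ _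

/-- Each orbit in `K ×_H X` has a unique representative with first entry `1`: the pair `(k, x)` is
equivalent to `(1, f⁻¹(k) x)`. Composing with an isomorphism therefore only relabels an action,
which keeps longer composites explicit. -/
theorem iso_comp [Finite K] (f : H ≃* K) (X : Biset H G) :
    CB.comp (CB.iso f) (CK.of X) = CK.of (resL f.symm.toMonoidHom X) := by
  refine comp_of_eq_of (fun (k : K) x => X.l (f.symm k) x) ?_ ?_ ?_
    (fun x => ((1 : K), x)) ?_ ?_
  · exact fun (k : K) h x => by simp [mul_l]
  · exact fun k (k' : K) x => by simp [mul_l]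
  · exact fun (k : K) x g => (X.comm _ _ _).symm
  · exact fun x => by simp [one_l]
  · exact fun (k : K) x => ⟨f.symm k⁻¹, by simp⟩

theorem comp_iso [Finite G] (f : K ≃* G) (X : Biset H G) :
    CB.comp (CK.of X) (CB.iso f) = CK.of (resR f.toMonoidHom X) := by
  refine comp_of_eq_of (fun x (g : G) => X.r x g) ?_ ?_ ?_ (fun x => (x, (1 : G))) ?_ ?_
  · exact fun x g (g' : G) => (X.mul_r _ _ _).symm
  · exact fun h x (g : G) => X.comm _ _ _
  · exact fun x (g : G) k => X.mul_r _ _ _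
  · exact fun x => X.one_r x
  · exact fun x (g : G) => ⟨g, by simp⟩

theorem prod_of (X : Biset H G) (Y : Biset K L) :
    CB.prod (CK.of X) (CK.of Y) = CK.of (prod X Y) := CK.lift₂_of _ _ _ _ _

theorem iso_comp_iso_symm [Finite G] [Finite H] (f : G ≃* H) :
    CB.comp (CB.iso f) (CB.iso f.symm) = CB.id H := by
  refine (iso_comp f (iso f.symm)).trans (of_eq_of_bijective (Y := Biset.id H) f f.bijective ?_ ?_)
  · exact fun h (x : G) => by simp
  · exact fun (x : G) g => by simp

/-! ### Self-duality of a finite group in the biset category. -/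

/-- The `(G × G, 1)`-biset `G`, on which `(g, h)` acts by `x ↦ g x h⁻¹`. -/
abbrev coev (G : Type) [Group G] [Finite G] : Biset (G × G) Unit where
  X := G
  fin := inferInstance
  l g x := g.1 * x * g.2⁻¹
  r x _ := x
  one_l := by simp
  mul_l := by simp [mul_assoc]
  one_r := by simp
  mul_r := by simp
  comm := by simp

/-- The `(1, G × G)`-biset `G`, on which `(g, h)` acts by `x ↦ g⁻¹ x h`. -/
abbrev ev (G : Type) [Group G] [Finite G] : Biset Unit (G × G) where
  X := G
  fin := inferInstance
  l _ x := x
  r x g := g.1⁻¹ * x * g.2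
  one_l := by simp
  mul_l := by simp
  one_r := by simp
  mul_r := by simp [mul_assoc]
  comm := by simp

/-- The triangle identity for the self-duality of `G` in the biset category. -/
theorem triangle (G : Type) [Group G] [Finite G] :
    CB.comp
      (CB.comp (CB.iso (MulEquiv.prodUnique : G × Unit ≃* G))
        (CB.comp (CB.prod (CB.id G) (CK.of (ev G)))
          (CB.iso (MulEquiv.prodAssoc : (G × G) × G ≃* G × (G × G)))))
      (CB.comp (CB.prod (CK.of (coev G)) (CB.id G))
        (CB.iso (MulEquiv.uniqueProd : Unit × G ≃* G).symm)) = CB.id G := by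
  rw [CB.id, prod_of, prod_of, comp_iso, comp_iso, iso_comp]
  -- After the relabellings both legs have underlying set `G × G`. The word `p₁ q₁ p₂ q₂` is the
  -- orbit invariant: an element `((g, h), k)` inserts `g`, `h⁻¹`, `k` between consecutive letters,
  -- whichever side it acts from.
  refine comp_of_eq_of (fun (p q : G × G) => (p.1 * q.1 * p.2 * q.2 : G)) ?_ ?_ ?_
    (fun (z : G) => (((1, 1), (1, z)) : (G × G) × (G × G))) ?_ ?_
  · intro (p : G × G) ((g, h), k) (q : G × G)
    show p.1 * g * q.1 * (h⁻¹ * p.2 * k) * q.2 = p.1 * (g * q.1 * h⁻¹) * p.2 * (k * q.2)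
    group
  · intro g (p : G × G) (q : G × G)
    show g * p.1 * q.1 * p.2 * q.2 = g * (p.1 * q.1 * p.2 * q.2)
    group
  · intro (p : G × G) (q : G × G) g
    exact (_root_.mul_assoc _ _ _).symm
  · intro (z : G)
    show (1 * 1 * 1 * z : G) = z
    group
  · intro (p : G × G) (q : G × G)
    -- Moving `(p, q)` to `((1, 1), (1, z))` by `((g, h), k)` forces `g = p₁⁻¹`, `k = (p₁ q₁ p₂)⁻¹`
    -- and `h = p₂ k`.
    refine ⟨((p.1⁻¹, p.2 * (p.1 * q.1 * p.2)⁻¹), (p.1 * q.1 * p.2)⁻¹), ?_⟩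
    refine Prod.ext (Prod.ext ?_ ?_) (Prod.ext ?_ ?_)
    · show 1 = p.1 * p.1⁻¹
      group
    · show 1 = (p.2 * (p.1 * q.1 * p.2)⁻¹)⁻¹ * p.2 * (p.1 * q.1 * p.2)⁻¹
      group
    · show 1 = p.1⁻¹⁻¹ * q.1 * (p.2 * (p.1 * q.1 * p.2)⁻¹)⁻¹⁻¹
      group
    · show p.1 * q.1 * p.2 * q.2 = (p.1 * q.1 * p.2)⁻¹⁻¹ * q.2
      group

/-- Naturality of the right unit `G × 1 ≅ G`. By linearity `φ` may be a biset `X`, and then both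
composites are `X` up to a one-point factor. -/
theorem prodUnique_comp [Finite G] [Finite H] (φ : CB H G) :
    CB.comp (CB.iso (MulEquiv.prodUnique : H × Unit ≃* H)) (CB.prod φ (CB.id Unit)) =
      CB.comp φ (CB.iso (MulEquiv.prodUnique : G × Unit ≃* G)) := by
  refine LinearMap.congr_fun
    (f := CB.comp (CB.iso (MulEquiv.prodUnique : H × Unit ≃* H)) ∘ₗ CB.prod.flip (CB.id Unit))
    (g := CB.comp.flip (CB.iso (MulEquiv.prodUnique : G × Unit ≃* G)))
    (CK.hom_ext fun X => ?_) φ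
  simp only [LinearMap.comp_apply, LinearMap.flip_apply]
  rw [CB.id, prod_of, iso_comp, comp_iso]
  exact of_eq_of_bijective (fun x : X.X × Unit => x.1)
    ⟨fun x y h => Prod.ext h rfl, fun x => ⟨(x, ()), rfl⟩⟩ (fun _ _ => rfl) fun _ _ => rfl

/-- Coherence between associator and right unit, needed to compare `(a × b) × m` with `a × (b × m)`
for `m ∈ M(1)`. -/
theorem prodUnique_comp_prodAssoc [Finite G] [Finite H] :
    CB.comp (CB.iso (MulEquiv.prodUnique : (G × H) × Unit ≃* G × H))
        (CB.iso (MulEquiv.prodAssoc : (G × H) × Unit ≃* G × (H × Unit)).symm) =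
      CB.prod (CB.id G) (CB.iso (MulEquiv.prodUnique : H × Unit ≃* H)) :=
  (comp_iso _ _).trans <| (of_eq_of_bijective (fun x : G × H => x) Function.bijective_id
    (fun _ _ => rfl) fun _ _ => rfl).trans (prod_of _ _).symm

end Biset

/-! ### Modules: detection at the trivial group and morphisms from `A`. -/

theorem BisetFunctor.map_iso_map_iso_symm (F : BisetFunctor.{v}) {G H : Type} [Group G] [Finite G]
    [Group H] [Finite H] (f : G ≃* H) (x : F.obj H) :
    F.map (CB.iso f) (F.map (CB.iso f.symm) x) = x := by
  rw [← LinearMap.comp_apply, ← F.map_comp, Biset.iso_comp_iso_symm, F.map_id]; rfl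

namespace GreenModule

variable {A : GreenBisetFunctor.{w}} (M : GreenModule.{v} A) {G : Type} [Group G] [Finite G]

/-- An element of `M(G)` is zero if all its products with elements of `A(G)` are killed by the
evaluation `M(G × G) → M(1)`, provided that the coevaluation element of `A(G × G)` is a combination
of products. -/
theorem eq_zero_of_map_ev_act_eq_zero
    (hA : A.map (CK.of (Biset.coev G)) A.one ∈
      Submodule.span ℂ {x | ∃ a b : A.obj G, x = A.mul a b}) (m : M.obj G)
    (hm : ∀ b : A.obj G, M.map (CK.of (Biset.ev G)) (M.act b m) = 0) : m = 0 := by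
  -- `F u` is the evaluation leg of the triangle applied to `u × m`; on a product `a × b` it gives
  -- `a × ev(b × m)`, up to `G × 1 ≅ G`.
  let F : A.obj (G × G) →ₗ[ℂ] M.obj G :=
    M.map (CB.comp (CB.iso (MulEquiv.prodUnique : G × Unit ≃* G))
      (CB.comp (CB.prod (CB.id G) (CK.of (Biset.ev G)))
        (CB.iso (MulEquiv.prodAssoc : (G × G) × G ≃* G × (G × G))))) ∘ₗ M.act.flip m
  have h0 : F (A.map (CK.of (Biset.coev G)) A.one) = 0 := by
    have h : Submodule.span ℂ {x | ∃ a b : A.obj G, x = A.mul a b} ≤ LinearMap.ker F := by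
      refine Submodule.span_le.2 ?_
      rintro _ ⟨a, b, rfl⟩
      refine LinearMap.mem_ker.2 ?_
      simp only [F, LinearMap.comp_apply, LinearMap.flip_apply, M.mul_act, M.map_comp,
        M.map_iso_map_iso_symm, M.map_prod, hm, map_zero]
    exact h hA
  -- The unit law turns `ε × m` into `m` transported to `1 × G`, so that `c × m` becomes the
  -- coevaluation leg applied to `m`.
  have h1 : M.act A.one m =
      M.map (CB.iso (MulEquiv.uniqueProd : Unit × G ≃* G).symm) m := by
    conv_rhs => rw [← M.one_act m]
    exact (M.map_iso_map_iso_symm (MulEquiv.uniqueProd : Unit × G ≃* G).symm _).symm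
  have h2 : M.act (A.map (CK.of (Biset.coev G)) A.one) m =
      M.map (CB.comp (CB.prod (CK.of (Biset.coev G)) (CB.id G))
        (CB.iso (MulEquiv.uniqueProd : Unit × G ≃* G).symm)) m := by
    rw [M.map_comp, LinearMap.comp_apply, ← h1, M.map_prod, M.map_id]; rfl
  -- It remains to see that `F c = m`, which is the triangle identity.
  rw [← h0]
  simp only [F, LinearMap.comp_apply, LinearMap.flip_apply]
  rw [h2, ← LinearMap.comp_apply, ← M.map_comp, Biset.triangle, M.map_id]; rfl

/-- The `A`-linear map `A → M` attached to an element of `M(1)`. -/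
def ofUnit (m : M.obj Unit) (G : Type) [Group G] [Finite G] : A.obj G →ₗ[ℂ] M.obj G :=
  M.map (CB.iso (MulEquiv.prodUnique : G × Unit ≃* G)) ∘ₗ M.act.flip m

theorem ofUnit_apply (m : M.obj Unit) (a : A.obj G) :
    M.ofUnit m G a = M.map (CB.iso (MulEquiv.prodUnique : G × Unit ≃* G)) (M.act a m) := rfl

/-- A module has only a left unit law; it applies because the two projections `1 × 1 → 1` coincide.
-/
theorem ofUnit_one (m : M.obj Unit) : M.ofUnit m Unit A.one = m := by
  have h : (MulEquiv.prodUnique : Unit × Unit ≃* Unit) = MulEquiv.uniqueProd :=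
    MulEquiv.ext fun _ => rfl
  rw [ofUnit_apply, h, M.one_act]

variable {H : Type} [Group H] [Finite H]

/-- Acting by `φ` on `a` alone is acting by `φ × id` on `a × m`, so this is naturality of the right
unit. -/
theorem ofUnit_map (m : M.obj Unit) (φ : CB H G) (a : A.obj G) :
    M.ofUnit m H (A.map φ a) = M.map φ (M.ofUnit m G a) := by
  have h : M.act (A.map φ a) m = M.map (CB.prod φ (CB.id Unit)) (M.act a m) := by
    rw [M.map_prod, M.map_id]; rfl
  rw [ofUnit_apply, h, ofUnit_apply, ← LinearMap.comp_apply (M.map _) (M.map _),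
    ← LinearMap.comp_apply (M.map _) (M.map _), ← M.map_comp, ← M.map_comp,
    Biset.prodUnique_comp]

/-- Associativity of the action, followed by the coherence of the right unit with the associator. -/
theorem ofUnit_mul (m : M.obj Unit) (a : A.obj G) (b : A.obj H) :
    M.ofUnit m (G × H) (A.mul a b) = M.act a (M.ofUnit m H b) := by
  have h : M.act a (M.ofUnit m H b) =
      M.map (CB.prod (CB.id G) (CB.iso (MulEquiv.prodUnique : H × Unit ≃* H)))
        (M.act a (M.act b m)) := by
    rw [M.map_prod, A.map_id]; rfl
  rw [h, ofUnit_apply, M.mul_act, ← LinearMap.comp_apply, ← M.map_comp,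
    Biset.prodUnique_comp_prodAssoc]

/-- If `A` is simple as a module over itself, a simple module that does not vanish at the trivial
group is isomorphic to `A`. -/
theorem nonempty_iso_self (hA : A.self.IsSimple) (hM : M.IsSimple) {m : M.obj Unit}
    (hm : m ≠ 0) : Nonempty (M.Iso A.self) := by
  let I : A.self.toBisetFunctor.Sub :=
    { sub := fun G _ _ => LinearMap.ker (M.ofUnit m G)
      map_mem := fun φ a ha => LinearMap.mem_ker.2 <| (M.ofUnit_map m φ a).trans <|
        (congrArg (M.map φ) (LinearMap.mem_ker.1 ha)).trans (map_zero _) }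
  let N : M.toBisetFunctor.Sub :=
    { sub := fun G _ _ => LinearMap.range (M.ofUnit m G)
      map_mem := by
        rintro G H _ _ _ _ φ _ ⟨a, rfl⟩
        exact ⟨A.map φ a, M.ofUnit_map m φ a⟩ }
  -- The kernel is a submodule of `A`; were it everything, it would contain `ε`, whose image is `m ≠
  -- 0`.
  have hI : I.IsZero := by
    refine (hA.2 I fun {G H} _ _ _ _ a b hb => ?_).resolve_right fun h => hm ?_
    · exact LinearMap.mem_ker.2 <| (M.ofUnit_mul m a b).trans <|
        (congrArg (M.act a) (LinearMap.mem_ker.1 hb)).trans (map_zero _)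
    · rw [← M.ofUnit_one m]
      exact LinearMap.mem_ker.1 ((h Unit).ge Submodule.mem_top)
  -- The image is a submodule of `M` that contains `m`, hence is not zero.
  have hN : N.IsAll := by
    refine (hM.2 N ?_).resolve_left fun h => hm ?_
    · rintro G H _ _ _ _ a _ ⟨b, rfl⟩
      exact ⟨A.mul a b, M.ofUnit_mul m a b⟩
    · exact (Submodule.mem_bot ℂ).1 ((h Unit).le ⟨A.one, M.ofUnit_one m⟩)
  let e (G : Type) [Group G] [Finite G] : A.obj G ≃ₗ[ℂ] M.obj G :=
    LinearEquiv.ofBijective (M.ofUnit m G)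
      ⟨LinearMap.ker_eq_bot.1 (hI G), LinearMap.range_eq_top.1 (hN G)⟩
  refine ⟨⟨fun G _ _ => (e G).symm, fun {G H} _ _ _ _ φ x => ?_,
    fun {G H} _ _ _ _ a x => ?_⟩⟩
  · obtain ⟨b, rfl⟩ := (e G).surjective x
    refine (LinearEquiv.symm_apply_eq _).2 ((M.ofUnit_map m φ b).symm.trans ?_)
    exact congrArg (fun t => e H (A.map φ t)) ((e G).symm_apply_apply b).symm
  · obtain ⟨b, rfl⟩ := (e H).surjective x
    refine (LinearEquiv.symm_apply_eq _).2 ((M.ofUnit_mul m a b).symm.trans ?_)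
    exact congrArg (fun t => e (G × H) (A.mul a t)) ((e H).symm_apply_apply b).symm

end GreenModule

/-! ### A simplicity criterion for Green biset functors. -/

namespace GreenBisetFunctor

variable {A : GreenBisetFunctor.{v}}

/-- A Green biset functor that is one-dimensional at the trivial group and whose coevaluation
elements are combinations of products is simple as a module over itself. -/
theorem isSimple_self (hA : ∀ (G : Type) [Group G] [Finite G],
      A.map (CK.of (Biset.coev G)) A.one ∈
        Submodule.span ℂ {x | ∃ a b : A.obj G, x = A.mul a b})
    (h0 : A.one ≠ 0) (h1 : ∀ x : A.obj Unit, ∃ z : ℂ, x = z • A.one) : A.self.IsSimple := by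
  refine ⟨⟨Unit, inferInstance, inferInstance, ⟨A.one, 0, h0⟩⟩, fun N hN => ?_⟩
  by_cases hz : A.one ∈ N.sub Unit
  · refine Or.inr fun G _ _ => eq_top_iff.2 fun a _ => ?_
    -- The unit `ε` generates: every `a` is `a × ε` transported along `G × 1 ≅ G`.
    have := N.map_mem (CB.iso (MulEquiv.prodUnique : G × Unit ≃* G)) _ (hN a _ hz)
    rwa [show A.self.map _ (A.self.act a A.one) = a from A.mul_one a] at this
  · refine Or.inl fun G _ _ => eq_bot_iff.2 fun m hm => (Submodule.mem_bot ℂ).2 ?_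
    -- Each `ev(b × m)` lies in `N(1)`, and it is a multiple of `ε`. Since `ε ∉ N(1)`, the multiple
    -- is zero.
    refine A.self.eq_zero_of_map_ev_act_eq_zero (hA G) m fun b => ?_
    let S : Submodule ℂ (A.obj Unit) := N.sub Unit
    let y : A.obj Unit := A.map (CK.of (Biset.ev G)) (A.mul b m)
    have hy : y ∈ S := N.map_mem (CK.of (Biset.ev G)) _ (hN b m hm)
    obtain ⟨z, hz'⟩ := h1 y
    rw [hz'] at hy
    have hz0 : z = 0 := by_contra fun h => hz ((S.smul_mem_iff h).1 hy)
    exact hz'.trans ((congrArg (· • A.one) hz0).trans (zero_smul ℂ _))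

/-- Two-sided ideals are in particular submodules of `A` over itself. -/
theorem isSimple_of_isSimple_self (h : A.self.IsSimple) : A.IsSimple :=
  ⟨h.1, fun I hI _ => h.2 I hI⟩

end GreenBisetFunctor

/-! ### Direct sums of representations and the value of `ℂR_ℂ` at the trivial group. -/

namespace FinRep

variable {G : Type} [Group G]

theorem of_eq_of_linearEquiv {V W : FinRep G} (e : V.V ≃ₗ[ℂ] W.V)
    (he : ∀ g v, e (V.ρ g v) = W.ρ g (e v)) : (CK.of V : CR G) = CK.of W :=
  of_eq_of_equiv e.toLinearMap e.symm.toLinearMap he (LinearMap.ext e.apply_symm_apply)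
    (LinearMap.ext e.symm_apply_apply)

/-- The direct sum of a finite family of representations. -/
abbrev pi {ι : Type} [Finite ι] (W : ι → FinRep G) : FinRep G where
  V := ∀ i, (W i).V
  ρ :=
    { toFun := fun g => LinearMap.pi fun i => (W i).ρ g ∘ₗ LinearMap.proj i
      map_one' := by ext; simp
      map_mul' := fun g h => by ext; simp }

theorem of_pi {n : ℕ} (W : Fin n → FinRep G) : (CK.of (pi W) : CR G) = ∑ i, CK.of (W i) := by
  induction n with
  | zero =>
    -- The empty direct sum is the zero space, so it splits as two copies of itself and its class
    -- satisfies `x = x + x`.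
    have h : Split (pi W) (pi W) (pi W) :=
      ⟨0, 0, 0, 0, by simp, by simp, by simp, by simp, Subsingleton.elim _ _,
        Subsingleton.elim _ _, Subsingleton.elim _ _, Subsingleton.elim _ _,
        Subsingleton.elim _ _⟩
    simpa using CK.of_rel h.rel
  | succ n ih =>
    rw [Fin.sum_univ_succ, ← ih]
    refine CK.of_rel (Split.rel ⟨LinearMap.single ℂ (fun i => (W i).V) 0,
      LinearMap.pi (Fin.cons 0 fun i => LinearMap.proj i), LinearMap.proj 0,
      LinearMap.pi fun i => LinearMap.proj i.succ, ?_, ?_, ?_, ?_, ?_, ?_, ?_, ?_, ?_⟩)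
    · intro g u
      funext i
      refine Fin.cases ?_ (fun i => ?_) i <;> simp
    · intro g u
      funext i
      refine Fin.cases ?_ (fun i => ?_) i <;> simp
    · intro g u
      simp
    · intro g u
      funext i
      simp
    · ext; simp
    · refine LinearMap.ext fun u => funext fun i => ?_
      simp
    · refine LinearMap.ext fun u => funext fun i => ?_
      simp
      rfl
    · refine LinearMap.ext fun u => ?_
      simp
    · refine LinearMap.ext fun u => funext fun i => ?_
      refine Fin.cases ?_ (fun i => ?_) i <;> simp

/-- The dimension, on the Grothendieck group. -/
def dim : CR G →ₗ[ℂ] ℂ :=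
  CK.lift (fun V => (Module.finrank ℂ V.V : ℂ)) fun V U W ⟨i, p, hi, hip, hp⟩ => by
    have h := LinearMap.finrank_range_add_finrank_ker p.toLinearMap
    rw [LinearMap.range_eq_top.2 hp, finrank_top,
      show LinearMap.ker p.toLinearMap = LinearMap.range i.toLinearMap from
        LinearMap.exact_iff.1 hip, LinearMap.finrank_range_of_inj hi] at h
    exact_mod_cast (h.symm.trans (add_comm _ _))

/-- Nonvanishing in a Grothendieck group needs an additive invariant; the dimension serves. -/
theorem of_triv_ne_zero : (CK.of triv : CR Unit) ≠ 0 := fun h => by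
  have h' : dim (CK.of triv : CR Unit) = 1 := (CK.lift_of _ _ _).trans (by simp)
  rw [h, map_zero] at h'
  exact zero_ne_one h'

/-- A basis identifies a representation of the trivial group with `dim V` copies of the trivial one.
-/
theorem exists_eq_smul_triv (x : CR Unit) : ∃ z : ℂ, x = z • (CK.of triv : CR Unit) := by
  induction x using CK.induction with
  | of V =>
    refine ⟨Module.finrank ℂ V.V, ?_⟩
    rw [of_eq_of_linearEquiv (W := pi fun _ : Fin (Module.finrank ℂ V.V) => triv)
      (Module.finBasis ℂ V.V).equivFun fun g v => ?_, of_pi]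
    · rw [Finset.sum_const, Finset.card_univ, Fintype.card_fin, Nat.cast_smul_eq_nsmul]
    · rw [show g = 1 from rfl, map_one, map_one]; rfl
  | zero => exact ⟨0, (zero_smul _ _).symm⟩
  | add x y hx hy =>
    obtain ⟨a, rfl⟩ := hx
    obtain ⟨b, rfl⟩ := hy
    exact ⟨a + b, (add_smul _ _ _).symm⟩
  | smul z x hx =>
    obtain ⟨a, rfl⟩ := hx
    exact ⟨z * a, (mul_smul _ _ _).symm⟩

/-! ### The Wedderburn decomposition of `ℂG` as a representation of `G × G`. -/

/-- The representation on column vectors given by a multiplicative map to matrices. -/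
abbrev ofMatrix {n : ℕ} (φ : G →* Matrix (Fin n) (Fin n) ℂ) : FinRep G where
  V := Fin n → ℂ
  ρ := (Matrix.toLinAlgEquiv' : _ ≃ₐ[ℂ] _).toMonoidHom.comp φ

/-- The dual of `ofMatrix φ`, on row vectors. -/
abbrev ofMatrixDual {n : ℕ} (φ : G →* Matrix (Fin n) (Fin n) ℂ) : FinRep G where
  V := Fin n → ℂ
  ρ :=
    { toFun := fun g => Matrix.toLin' (φ g⁻¹).transpose
      map_one' := by simp; rfl
      map_mul' := fun g h => by simp; rfl }

/-- Matrices as tensors. -/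
def matrixEquiv (n : ℕ) :
    Matrix (Fin n) (Fin n) ℂ ≃ₗ[ℂ] (Fin n → ℂ) ⊗[ℂ] (Fin n → ℂ) :=
  -- `piScalarRight` makes the index of the second tensor factor the outer one; the transpose lets
  -- `x ⊗ y` correspond to the matrix `x yᵀ`.
  Matrix.transposeLinearEquiv (Fin n) (Fin n) ℂ ℂ ≪≫ₗ
    (TensorProduct.piScalarRight ℂ ℂ (Fin n → ℂ) (Fin n)).symm

theorem matrixEquiv_symm_tmul {n : ℕ} (x y : Fin n → ℂ) :
    (matrixEquiv n).symm (x ⊗ₜ y) = Matrix.vecMulVec x y := by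
  ext i j
  show TensorProduct.piScalarRight ℂ ℂ (Fin n → ℂ) (Fin n) (x ⊗ₜ y) j i = x i * y j
  simp [mul_comm]

/-- On a rank-one matrix, `φ(g) (x yᵀ) φ(h⁻¹) = (φ(g) x) (φ(h⁻¹)ᵀ y)ᵀ`, and such matrices span. -/
theorem matrixEquiv_mul {n : ℕ} (φ : G →* Matrix (Fin n) (Fin n) ℂ) (g : G × G)
    (M : Matrix (Fin n) (Fin n) ℂ) :
    matrixEquiv n (φ g.1 * M * φ g.2⁻¹) =
      (ext (ofMatrix φ) (ofMatrixDual φ)).ρ g (matrixEquiv n M) := by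
  obtain ⟨t, rfl⟩ := (matrixEquiv n).symm.surjective M
  rw [LinearEquiv.apply_symm_apply, ← LinearEquiv.eq_symm_apply]
  induction t using TensorProduct.induction_on with
  | zero => simp
  | tmul x y =>
    refine Eq.trans ?_ (matrixEquiv_symm_tmul _ _).symm
    rw [matrixEquiv_symm_tmul, Matrix.mul_vecMulVec, Matrix.vecMulVec_mul]
    congr 1
    exact (Matrix.mulVec_transpose _ _).symm
  | add s t hs ht => simp only [map_add, mul_add, add_mul, hs, ht]

/-- The permutation representation of `G × G` on `ℂG` is a sum of external products. -/
theorem tensor_coev_mem_span [Finite G] :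
    (CK.of (Biset.tensor (Biset.coev G) triv) : CR (G × G)) ∈
      Submodule.span ℂ {x | ∃ a b : CR G, x = CR.mul a b} := by
  -- Maschke and Wedderburn over the algebraically closed field `ℂ`: the group algebra is a product
  -- of full matrix algebras. The `φ i` below are the coordinates of `e` restricted to `G`.
  obtain ⟨n, d, -, ⟨e⟩⟩ :=
    IsSemisimpleRing.exists_algEquiv_pi_matrix_of_isAlgClosed ℂ (MonoidAlgebra ℂ G)
  let φ (i : Fin n) : G →* Matrix (Fin (d i)) (Fin (d i)) ℂ :=
    ((Pi.evalMonoidHom _ i).comp e.toMonoidHom).comp (MonoidAlgebra.of ℂ G)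
  let W : FinRep (G × G) := pi fun i => ext (ofMatrix (φ i)) (ofMatrixDual (φ i))
  let E : MonoidAlgebra ℂ G ≃ₗ[ℂ] W.V :=
    e.toLinearEquiv ≪≫ₗ LinearEquiv.piCongrRight fun i => matrixEquiv (d i)
  -- `p` and `q` are the mutually inverse identifications of `ℂ[coev G] ⊗ ℂ` with `ℂG`.
  let p : Biset.TensorSpace (Biset.coev G) triv →ₗ[ℂ] MonoidAlgebra ℂ G :=
    Biset.tlift (fun x : G => (MonoidAlgebra.lsingle x : ℂ →ₗ[ℂ] MonoidAlgebra ℂ G))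
      fun _ _ _ => rfl
  let q : MonoidAlgebra ℂ G →ₗ[ℂ] Biset.TensorSpace (Biset.coev G) triv :=
    Finsupp.lsum ℂ (fun x : G => Biset.tmk (Biset.coev G) triv x) ∘ₗ
      (MonoidAlgebra.coeffLinearEquiv ℂ).toLinearMap
  have hp : ∀ (x : G) (z : ℂ), p (Biset.tmk _ triv x z) = MonoidAlgebra.single x z :=
    fun x z => Biset.tlift_mk _ _ _ _
  have hq : ∀ (x : G) (z : ℂ), q (MonoidAlgebra.single x z) = Biset.tmk _ triv x z :=
    fun x z => by simp [q]
  have key : (CK.of (Biset.tensor (Biset.coev G) triv) : CR (G × G)) = CK.of W := by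
    refine of_eq_of_equiv (E.toLinearMap ∘ₗ p) (q ∘ₗ E.symm.toLinearMap) (fun g => ?_) ?_ ?_
    · refine LinearMap.congr_fun
        (f := (E.toLinearMap ∘ₗ p) ∘ₗ (Biset.tensor (Biset.coev G) triv).ρ g)
        (g := W.ρ g ∘ₗ (E.toLinearMap ∘ₗ p)) (Biset.thom_ext fun (x : G) (z : ℂ) => ?_)
      simp only [LinearMap.comp_apply]
      rw [Biset.tensor_ρ_mk, hp, hp]
      funext i
      -- The action of `(g, h)` on `ℂG` is multiplication by `g` on the left and `h⁻¹` on the right,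
      -- so the algebra map `e` carries it to matrix multiplication on each block.
      have h : MonoidAlgebra.single (g.1 * x * g.2⁻¹) z =
          MonoidAlgebra.of ℂ G g.1 * MonoidAlgebra.single x z * MonoidAlgebra.of ℂ G g.2⁻¹ := by
        simp [MonoidAlgebra.single_mul_single]
      show matrixEquiv (d i) (e (MonoidAlgebra.single (g.1 * x * g.2⁻¹) z) i) = _
      rw [h, map_mul, map_mul]
      exact matrixEquiv_mul (φ i) g _
    · refine LinearMap.ext fun t => ?_
      have h : p ∘ₗ q = LinearMap.id := MonoidAlgebra.lhom_ext' fun x => LinearMap.ext fun z => by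
        show p (q (MonoidAlgebra.single x z)) = _
        rw [hq, hp]; rfl
      show E (p (q (E.symm t))) = t
      rw [← LinearMap.comp_apply p q, h, LinearMap.id_apply, E.apply_symm_apply]
    · refine Biset.thom_ext fun x z => ?_
      show q (E.symm (E (p _))) = _
      rw [E.symm_apply_apply, hp, hq]; rfl
  rw [key, of_pi]
  exact Submodule.sum_mem _ fun i _ => Submodule.subset_span ⟨_, _, (CR.mul_of _ _).symm⟩

end FinRep

/-! ### Application to `ℂR_ℂ`. -/

theorem complexRep_coev_mem_span (G : Type) [Group G] [Finite G] :
    complexRep.map (CK.of (Biset.coev G)) complexRep.one ∈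
      Submodule.span ℂ {x | ∃ a b : complexRep.obj G, x = complexRep.mul a b} := by
  have h : complexRep.map (CK.of (Biset.coev G)) complexRep.one =
    CK.of (Biset.tensor (Biset.coev G) FinRep.triv) := CR.map_of _ _
  rw [h]
  exact FinRep.tensor_coev_mem_span

theorem complexRep_isSimple_self : complexRep.self.IsSimple :=
  GreenBisetFunctor.isSimple_self complexRep_coev_mem_span FinRep.of_triv_ne_zero
    FinRep.exists_eq_smul_triv

/-- If `M(1) = 0`, all the `ev(b × m)` vanish for trivial reasons, and then so does every `m`. -/
theorem GreenModule.exists_ne_zero {M : GreenModule.{v} complexRep} (hM : M.IsNonzero) :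
    ∃ m : M.obj Unit, m ≠ 0 := by
  obtain ⟨G, _, _, _⟩ := hM
  obtain ⟨m, hm⟩ := exists_ne (0 : M.obj G)
  by_contra! h
  exact hm (M.eq_zero_of_map_ev_act_eq_zero (complexRep_coev_mem_span G) m fun b => h _)

end GreenBiset

end

theorem proposition4p3 :
    (GreenBiset.complexRep.self.IsSimple ∧
      ∀ M : GreenBiset.GreenModule.{v} GreenBiset.complexRep,
        M.IsSimple → Nonempty (M.Iso GreenBiset.complexRep.self)) ∧
    GreenBiset.complexRep.IsSimple := by
  refine ⟨⟨GreenBiset.complexRep_isSimple_self, fun M hM => ?_⟩,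
    GreenBiset.GreenBisetFunctor.isSimple_of_isSimple_self GreenBiset.complexRep_isSimple_self⟩
  obtain ⟨m, hm⟩ := GreenBiset.GreenModule.exists_ne_zero hM.1
  exact M.nonempty_iso_self GreenBiset.complexRep_isSimple_self hM hm
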